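/- Let $d\in\mathbb{N}$. For $s,r>0$ the Gelfand--Shilov space $S^s_r(\mathbb{R}^d)$ is the space of all Schwartz functions $f:\mathbb{R}^d\to\mathbb{C}$ for which there are constants $A,B,M>0$ with $$|x^\alpha\partial^\beta f(x)|\le M\,A^{|\alpha|}B^{|\beta|}(\alpha!)^r(\beta!)^s\qquad\text{for all }x\in\mathbb{R}^d,\ \alpha,\beta\in\mathbb{N}^d.$$ It carries its usual topology, the locally convex inductive limit over $A,B>0$ of the Banach spaces of those $f$ that satisfy this estimate with given $A,B$ and some $M$, normed by the least such $M$. Let $s\ge 1/2$ and let $\sigma\in\mathcal{C}^\infty(\mathbb{R}^{2d})$ be a complex-valued symbol for which there are constants $c,C>0$ with $$|\partial^\alpha\sigma(z)|\le c\,C^{|\alpha|}(\alpha!)^s\qquad\text{for all }z\in\mathbb{R}^{2d},\ \alpha\in\mathbb{N}^{2d}.$$ Then the Weyl operator $\sigma^w$, $$\sigma^wf(x)=\int_{\mathbb{R}^d}\Big(\int_{\mathbb{R}^d}e^{2\pi i(x-y)\cdot\xi}\,\sigma\Big(\frac{x+y}{2},\xi\Big)f(y)\,dy\Big)\,d\xi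 ,$$ is bounded on $S^s_s(\mathbb{R}^d)$: for every $f\in S^s_s(\mathbb{R}^d)$ and every $x\in\mathbb{R}^d$ the inner integral (for each $\xi$) and the outer integral converge absolutely, $\sigma^wf$ belongs to $S^s_s(\mathbb{R}^d)$, and $\sigma^w:S^s_s(\mathbb{R}^d)\to S^s_s(\mathbb{R}^d)$ is linear and continuous. -/

import Mathlib

open MeasureTheory
open scoped SchwartzMap ContDiff

noncomputable section

/-- The mixed partial derivative `∂^α f (x)`, `α ∈ ℕ^n`, along the coordinate directions
`e 0, …, e (n-1)`: the `|α|`-th derivative of `f` at `x`, evaluated on the family that contains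
each `e i` exactly `α i` times. -/
def multiDeriv {E : Type*} [NormedAddCommGroup E] [NormedSpace ℝ E] {n : ℕ}
    (e : Fin n → E) (α : Fin n → ℕ) (f : E → ℂ) (x : E) : ℂ :=
  iteratedFDeriv ℝ (∑ i, α i) f x (fun k => e (finSigmaFinEquiv.symm k).1)

/-- `α! = α_1! ⋯ α_n!`. -/
def multiFactorial {n : ℕ} (α : Fin n → ℕ) : ℕ := ∏ i, (α i).factorial

/-- The standard basis of `ℝ^d`. -/
def stdBasis (d : ℕ) (i : Fin d) : EuclideanSpace ℝ (Fin d) := EuclideanSpace.single i 1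

/-- The standard basis of `ℝ^{2d} = ℝ^d × ℝ^d`: first the `d` directions of the variable `x`,
then the `d` directions of the variable `ξ`. -/
def stdBasisPhase (d : ℕ) :
    Fin (d + d) → EuclideanSpace ℝ (Fin d) × EuclideanSpace ℝ (Fin d) :=
  Fin.append (fun i => (stdBasis d i, 0)) (fun i => (0, stdBasis d i))

/-- The estimates `|x^α ∂^β f(x)| ≤ M A^{|α|} B^{|β|} (α!)^r (β!)^s` for all `x`, `α`, `β`. -/
def GelfandShilovBound {d : ℕ} (s r A B M : ℝ) (f : EuclideanSpace ℝ (Fin d) → ℂ) : Prop :=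
  ∀ (α β : Fin d → ℕ) (x : EuclideanSpace ℝ (Fin d)),
    ‖((∏ i, x i ^ α i : ℝ) : ℂ) * multiDeriv (stdBasis d) β f x‖ ≤
      M * A ^ (∑ i, α i) * B ^ (∑ i, β i) *
        (multiFactorial α : ℝ) ^ r * (multiFactorial β : ℝ) ^ s

theorem multiDeriv_add {d : ℕ} (β : Fin d → ℕ) (f g : 𝓢(EuclideanSpace ℝ (Fin d), ℂ))
    (x : EuclideanSpace ℝ (Fin d)) :
    multiDeriv (stdBasis d) β (⇑(f + g)) x =
      multiDeriv (stdBasis d) β f x + multiDeriv (stdBasis d) β g x := by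
  unfold multiDeriv
  have h : (⇑(f + g) : EuclideanSpace ℝ (Fin d) → ℂ) = ⇑f + ⇑g := by
    ext y; simp
  rw [h, iteratedFDeriv_add ((f.smooth ⊤).of_le (by exact_mod_cast le_top))
    ((g.smooth ⊤).of_le (by exact_mod_cast le_top))]
  rfl

theorem multiDeriv_smul {d : ℕ} (β : Fin d → ℕ) (c : ℂ)
    (f : 𝓢(EuclideanSpace ℝ (Fin d), ℂ)) (x : EuclideanSpace ℝ (Fin d)) :
    multiDeriv (stdBasis d) β (⇑(c • f)) x = c * multiDeriv (stdBasis d) β f x := by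
  unfold multiDeriv
  have h : (⇑(c • f) : EuclideanSpace ℝ (Fin d) → ℂ) = c • ⇑f := by
    ext y; simp
  rw [h, iteratedFDeriv_const_smul_apply
    (((f.smooth ⊤).of_le (by exact_mod_cast le_top)).contDiffAt)]
  rfl

theorem GelfandShilovBound.const_nonneg {d : ℕ} {s r A B M : ℝ}
    {f : EuclideanSpace ℝ (Fin d) → ℂ} (h : GelfandShilovBound s r A B M f) : 0 ≤ M := by
  simpa [multiFactorial] using (norm_nonneg _).trans (h 0 0 0)

theorem GelfandShilovBound.mono {d : ℕ} {s r A B M A' B' : ℝ}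
    {f : EuclideanSpace ℝ (Fin d) → ℂ} (h : GelfandShilovBound s r A B M f)
    (hA : 0 < A) (hB : 0 < B) (hA' : A ≤ A') (hB' : B ≤ B') :
    GelfandShilovBound s r A' B' M f := by
  intro α β x
  have hM := h.const_nonneg
  have hA0 := hA.trans_le hA'
  refine (h α β x).trans ?_
  gcongr

theorem GelfandShilovBound.add {d : ℕ} {s r A B M N : ℝ}
    {f g : 𝓢(EuclideanSpace ℝ (Fin d), ℂ)} (hf : GelfandShilovBound s r A B M f)
    (hg : GelfandShilovBound s r A B N g) :
    GelfandShilovBound s r A B (M + N) (⇑(f + g)) := by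
  intro α β x
  rw [multiDeriv_add, mul_add]
  refine (norm_add_le _ _).trans ((add_le_add (hf α β x) (hg α β x)).trans (le_of_eq ?_))
  ring

theorem GelfandShilovBound.smul {d : ℕ} {s r A B M : ℝ} (c : ℂ)
    {f : 𝓢(EuclideanSpace ℝ (Fin d), ℂ)} (hf : GelfandShilovBound s r A B M f) :
    GelfandShilovBound s r A B (‖c‖ * M) (⇑(c • f)) := by
  intro α β x
  rw [multiDeriv_smul, mul_left_comm, norm_mul]
  refine (mul_le_mul_of_nonneg_left (hf α β x) (norm_nonneg c)).trans (le_of_eq ?_)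
  ring

/-- The Gelfand–Shilov functions of type `S^s_r(ℝ^d)`, as a subspace of the Schwartz space. -/
def gelfandShilovSubmodule (d : ℕ) (s r : ℝ) :
    Submodule ℂ 𝓢(EuclideanSpace ℝ (Fin d), ℂ) where
  carrier := {f | ∃ A > 0, ∃ B > 0, ∃ M, GelfandShilovBound s r A B M f}
  zero_mem' := by
    refine ⟨1, one_pos, 1, one_pos, 0, fun α β x => ?_⟩
    have h := multiDeriv_smul β 0 (0 : 𝓢(EuclideanSpace ℝ (Fin d), ℂ)) x
    rw [zero_smul, zero_mul] at h
    rw [h]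
    simp
  add_mem' := by
    rintro f g ⟨A, hA, B, hB, M, hf⟩ ⟨A', hA', B', hB', M', hg⟩
    exact ⟨max A A', lt_max_of_lt_left hA, max B B', lt_max_of_lt_left hB, M + M',
      (hf.mono hA hB (le_max_left _ _) (le_max_left _ _)).add
        (hg.mono hA' hB' (le_max_right _ _) (le_max_right _ _))⟩
  smul_mem' := by
    rintro c f ⟨A, hA, B, hB, M, hf⟩
    exact ⟨A, hA, B, hB, ‖c‖ * M, hf.smul c⟩

/-- The Gelfand–Shilov space `S^s_r(ℝ^d)`. It is a type of its own, since its topology is not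
the one induced by the Schwartz space. -/
def GelfandShilov (d : ℕ) (s r : ℝ) : Type := ↥(gelfandShilovSubmodule d s r)

instance GelfandShilov.instAddCommGroup (d : ℕ) (s r : ℝ) : AddCommGroup (GelfandShilov d s r) :=
  inferInstanceAs (AddCommGroup ↥(gelfandShilovSubmodule d s r))

instance GelfandShilov.instModule (d : ℕ) (s r : ℝ) : Module ℂ (GelfandShilov d s r) :=
  inferInstanceAs (Module ℂ ↥(gelfandShilovSubmodule d s r))

/-- The inclusion of `S^s_r(ℝ^d)` into the Schwartz space. -/
def GelfandShilov.toSchwartz {d : ℕ} {s r : ℝ} :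
    GelfandShilov d s r →ₗ[ℂ] 𝓢(EuclideanSpace ℝ (Fin d), ℂ) :=
  (gelfandShilovSubmodule d s r).subtype

/-- The seminorms on `S^s_r(ℝ^d)` that are continuous on each of the Banach spaces
`S^{s,B}_{r,A}`, `A, B > 0`, whose norm of `f` is the least `M` with
`GelfandShilovBound s r A B M f`. -/
def GelfandShilov.stepContinuousSeminorms (d : ℕ) (s r : ℝ) :
    Set (Seminorm ℂ (GelfandShilov d s r)) :=
  {p | ∀ A > 0, ∀ B > 0, ∃ K : ℝ, ∀ (f : GelfandShilov d s r) (M : ℝ),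
    GelfandShilovBound s r A B M (GelfandShilov.toSchwartz f) → p f ≤ K * M}

instance GelfandShilov.instNonemptySeminorms (d : ℕ) (s r : ℝ) :
    Nonempty ↥(GelfandShilov.stepContinuousSeminorms d s r) :=
  ⟨⟨0, fun _ _ _ _ => ⟨0, fun _ _ _ => by simp⟩⟩⟩

/-- The topology of `S^s_r(ℝ^d)`: the locally convex inductive limit of the Banach spaces
`S^{s,B}_{r,A}`, that is the locally convex topology defined by all the seminorms that are
continuous on every step. -/
instance GelfandShilov.instTopologicalSpace (d : ℕ) (s r : ℝ) :
    TopologicalSpace (GelfandShilov d s r) :=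
  (SeminormFamily.moduleFilterBasis (𝕜 := ℂ) (F := GelfandShilov d s r)
    (ι := ↥(GelfandShilov.stepContinuousSeminorms d s r)) Subtype.val).topology

/-- The integrand `e^{2πi(x-y)·ξ} σ((x+y)/2, ξ) f(y)` of the Weyl quantization. -/
def weylIntegrand {d : ℕ} (σ : EuclideanSpace ℝ (Fin d) × EuclideanSpace ℝ (Fin d) → ℂ)
    (f : EuclideanSpace ℝ (Fin d) → ℂ) (x ξ y : EuclideanSpace ℝ (Fin d)) : ℂ :=
  Complex.exp (2 * Real.pi * Complex.I * ((inner ℝ (x - y) ξ : ℝ) : ℂ)) *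
    σ ((1 / 2 : ℝ) • (x + y), ξ) * f y

/-- The Weyl operator `σ^w f (x) = ∫ (∫ e^{2πi(x-y)·ξ} σ((x+y)/2, ξ) f(y) dy) dξ`. -/
def weylOperator {d : ℕ} (σ : EuclideanSpace ℝ (Fin d) × EuclideanSpace ℝ (Fin d) → ℂ)
    (f : EuclideanSpace ℝ (Fin d) → ℂ) (x : EuclideanSpace ℝ (Fin d)) : ℂ :=
  ∫ ξ, ∫ y, weylIntegrand σ f x ξ y

end

/-! The proof rests on two commutation relations. Differentiating under the integral and integrating
by parts in `y` gives `∂_j σ^w f = (∂_{x_j} σ)^w f + σ^w (∂_j f)`; integrating by parts in `ξ` gives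
`x_j σ^w f = σ^w (x_j f) - (2πi)⁻¹ (∂_{ξ_j} σ)^w f` (`dirDeriv_weylOperator`,
`coord_mul_weylOperator`). Iterated, they write `x^α ∂^β σ^w f` as a sum of `2^{|α|+|β|}` terms `τ^w
g` with coefficients of modulus at most 1, where `τ = ∂_x^δ ∂_ξ^γ σ`, `g = x^{γ'} ∂^{δ'} f`, `γ + γ'
= α` and `δ + δ' = β`.

Each term is controlled by the sup-norm estimate `exists_norm_weylOperator_le`: `|τ^w g|` is at most
a constant times a bound for `d + 1` derivatives of `τ` and a bound for `d + 1` derivatives of `g`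
with weight `(1 + |y|)^{d+1}`. The weight makes the `y`-integral converge, and the derivatives give
the inner integral the decay `(1 + |ξ|)^{-(d+1)}`.

The fixed number of extra derivatives and weights changes only the constants and geometric rates in
the Gevrey bounds. Since `γ! γ'! ≤ α!` and `δ! δ'! ≤ β!`, every term obeys one bound of the form `K
M D^{|α|+|β|} (α! β!)^s`; the number of terms turns `D` into `2 D`. Thus each step of the inductive
limit is mapped boundedly into another step, and continuity follows from the description of the
topology by seminorms.

That `σ^w f` is a Schwartz function also follows from the commutation relations: the span of all
such functions consists of bounded differentiable functions and is closed under partial derivatives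
and multiplication by coordinates. -/

/-- The directional derivative of `f` along the constant vector field `v`. -/
noncomputable def dirDeriv {E : Type*} [NormedAddCommGroup E] [NormedSpace ℝ E] (v : E)
    (f : E → ℂ) : E → ℂ :=
  fun x => fderiv ℝ f x v

/-! ### Mixed partial derivatives as iterated directional derivatives -/

section MultiDeriv

variable {E : Type*} [NormedAddCommGroup E] [NormedSpace ℝ E] {n : ℕ}

theorem ContDiff.dirDeriv {f : E → ℂ} (hf : ContDiff ℝ ∞ f) (v : E) :
    ContDiff ℝ ∞ (dirDeriv v f) :=
  (hf.fderiv_right (m := ∞) le_rfl).clm_apply contDiff_const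

theorem ContDiff.foldr_dirDeriv {f : E → ℂ} (hf : ContDiff ℝ ∞ f) (l : List E) :
    ContDiff ℝ ∞ (l.foldr _root_.dirDeriv f) := by
  induction l with
  | nil => exact hf
  | cons v l ih => exact ih.dirDeriv v

theorem dirDeriv_comm {f : E → ℂ} (hf : ContDiff ℝ ∞ f) (v w : E) :
    dirDeriv v (dirDeriv w f) = dirDeriv w (dirDeriv v f) := by
  have hd : Differentiable ℝ (fderiv ℝ f) :=
    (hf.fderiv_right (m := ∞) le_rfl).differentiable (by simp)
  have key : ∀ a b x, dirDeriv a (dirDeriv b f) x = fderiv ℝ (fderiv ℝ f) x a b := by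
    intro a b x
    change fderiv ℝ (fun y => fderiv ℝ f y b) x a = _
    rw [((hd x).hasFDerivAt.clm_apply (hasFDerivAt_const b x)).fderiv]
    simp
  ext x
  rw [key, key]
  exact (hf.contDiffAt.isSymmSndFDerivAt (by simp; exact WithTop.coe_le_coe.2 le_top)).eq v w

theorem List.Perm.foldr_dirDeriv_eq {l l' : List E} (h : l.Perm l') {f : E → ℂ}
    (hf : ContDiff ℝ ∞ f) : l.foldr dirDeriv f = l'.foldr dirDeriv f := by
  induction h with
  | nil => rfl
  | cons v _ ih => simp [ih]
  | swap v w l => exact dirDeriv_comm (hf.foldr_dirDeriv l) w v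
  | trans _ _ ih₁ ih₂ => exact ih₁.trans ih₂

/-- With the directions collected in a list, symmetry of higher derivatives becomes invariance under
`List.Perm`, which needs only the commutation of two adjacent derivatives. -/
theorem iteratedFDeriv_eq_foldr_dirDeriv {k : ℕ} {f : E → ℂ} (hf : ContDiff ℝ ∞ f)
    (u : Fin k → E) (x : E) :
    iteratedFDeriv ℝ k f x u = (List.ofFn u).foldr dirDeriv f x := by
  induction k generalizing f with
  | zero => simp
  | succ k ih =>
    have h : dirDeriv (u (Fin.last k)) f =
        (ContinuousLinearMap.apply ℝ ℂ (u (Fin.last k))) ∘ fderiv ℝ f := by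
      ext y; simp [dirDeriv]
    rw [List.ofFn_succ', List.concat_eq_append, List.foldr_append, List.foldr_cons,
      List.foldr_nil, iteratedFDeriv_succ_apply_right]
    refine Eq.trans ?_ (ih (hf.dirDeriv _) (fun i => u i.castSucc))
    rw [h, ContinuousLinearMap.iteratedFDeriv_comp_left _
      (hf.fderiv_right (m := ∞) le_rfl).contDiffAt
      (i := k) (by exact_mod_cast le_top)]
    rfl

/-- Iterated derivatives of a smooth function along two families of coordinate directions agree
if every direction occurs equally often in both. -/
theorem iteratedFDeriv_congr_of_card_fiber {f : E → ℂ} (hf : ContDiff ℝ ∞ f) (e : Fin n → E)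
    {k m : ℕ} (u : Fin k → Fin n) (v : Fin m → Fin n)
    (h : ∀ i, Fintype.card {a // u a = i} = Fintype.card {a // v a = i}) (x : E) :
    iteratedFDeriv ℝ k f x (fun a => e (u a)) = iteratedFDeriv ℝ m f x (fun a => e (v a)) := by
  -- Bijections between the fibres glue to a bijection `φ` of the index sets with `v ∘ φ = u`. It
  -- forces `k = m`, and substituting this equality makes `φ` a permutation of one `Fin k`.
  have g : ∀ i, {a // u a = i} ≃ {a // v a = i} := fun i => Fintype.equivOfCardEq (h i)
  have hmap := Equiv.ofFiberEquiv_map g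
  generalize Equiv.ofFiberEquiv g = φ at hmap
  obtain rfl : k = m := by simpa using Fintype.card_congr φ
  have hu : (fun a => e (u a)) = (fun a => e (v a)) ∘ φ := by
    ext a
    simp [hmap]
  rw [iteratedFDeriv_eq_foldr_dirDeriv hf, iteratedFDeriv_eq_foldr_dirDeriv hf, hu,
    (Equiv.Perm.ofFn_comp_perm φ _).foldr_dirDeriv_eq hf]

theorem card_fiber_finSigmaFinEquiv (α : Fin n → ℕ) (i : Fin n) :
    Fintype.card {a : Fin (∑ i, α i) // (finSigmaFinEquiv.symm a).1 = i} = α i := by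
  rw [Fintype.card_congr ((finSigmaFinEquiv (n := α)).symm.subtypeEquiv
    (q := fun p => p.1 = i) (fun a => Iff.rfl)),
    Fintype.card_congr (Equiv.sigmaSubtype (β := fun i => Fin (α i)) i), Fintype.card_fin]

theorem multiDeriv_zero (e : Fin n → E) (f : E → ℂ) : multiDeriv e 0 f = f := by
  ext x
  unfold multiDeriv
  have h : ∀ k, k = 0 → ∀ u : Fin k → E, iteratedFDeriv ℝ k f x u = f x := by
    rintro _ rfl u
    simp
  exact h _ (by simp) _

/-- This recursion isolates one derivative next to `f`; with `multiIndex_induction` it replaces all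
further handling of `finSigmaFinEquiv`. -/
theorem multiDeriv_add_single (e : Fin n → E) (α : Fin n → ℕ) (j : Fin n) {f : E → ℂ}
    (hf : ContDiff ℝ ∞ f) :
    multiDeriv e (α + Pi.single j 1) f = multiDeriv e α (dirDeriv (e j) f) := by
  ext x
  unfold multiDeriv
  have h1 := iteratedFDeriv_congr_of_card_fiber hf e
    (fun k : Fin (∑ i, (α + Pi.single j 1 : Fin n → ℕ) i) => (finSigmaFinEquiv.symm k).1)
    -- The new direction is put in the last slot, which is the innermost derivative in the `foldr`.
    (Fin.snoc (α := fun _ => Fin n) (fun k : Fin (∑ i, α i) => (finSigmaFinEquiv.symm k).1) j)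
    (fun i => by
      rw [card_fiber_finSigmaFinEquiv]
      have h2 := card_fiber_finSigmaFinEquiv α i
      simp only [Fintype.card_subtype, Finset.card_filter, Fin.sum_univ_castSucc,
        Fin.snoc_castSucc, Fin.snoc_last] at h2 ⊢
      rw [h2]
      simp [Pi.single_apply, eq_comm]) x
  rw [h1, iteratedFDeriv_eq_foldr_dirDeriv hf, iteratedFDeriv_eq_foldr_dirDeriv (hf.dirDeriv _),
    List.ofFn_succ', List.concat_eq_append, List.foldr_append]
  simp

theorem exists_add_single_of_sum_eq_succ {α : Fin n → ℕ} {m : ℕ} (h : ∑ i, α i = m + 1) :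
    ∃ (α₀ : Fin n → ℕ) (j : Fin n), α = α₀ + Pi.single j 1 ∧ ∑ i, α₀ i = m := by
  obtain ⟨j, -, hj⟩ := Finset.exists_ne_zero_of_sum_ne_zero (h.trans_ne m.succ_ne_zero)
  have hα : α = (α - Pi.single j 1) + Pi.single j 1 := by
    ext i
    rcases eq_or_ne i j with rfl | hi
    · simp; omega
    · simp [hi]
  refine ⟨_, j, hα, ?_⟩
  rw [hα] at h
  simpa [Finset.sum_add_distrib] using h

/-- Induction on the order of a multi-index. -/
theorem multiIndex_induction {P : (Fin n → ℕ) → Prop} (zero : P 0)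
    (step : ∀ α j, P α → P (α + Pi.single j 1)) (α : Fin n → ℕ) : P α := by
  generalize h : ∑ i, α i = m
  induction m generalizing α with
  | zero =>
    obtain rfl : α = 0 := by
      ext i
      exact (Finset.sum_eq_zero_iff.1 h) i (Finset.mem_univ i)
    exact zero
  | succ m ih =>
    obtain ⟨α₀, j, rfl, h₀⟩ := exists_add_single_of_sum_eq_succ h
    exact step α₀ j (ih α₀ h₀)

theorem ContDiff.multiDeriv {f : E → ℂ} (hf : ContDiff ℝ ∞ f) (e : Fin n → E) (α : Fin n → ℕ) :
    ContDiff ℝ ∞ (multiDeriv e α f) := by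
  induction α using multiIndex_induction generalizing f with
  | zero => rwa [multiDeriv_zero]
  | step α j ih => rw [multiDeriv_add_single e α j hf]; exact ih (hf.dirDeriv _)

theorem multiDeriv_multiDeriv (e : Fin n → E) (α β : Fin n → ℕ) {f : E → ℂ}
    (hf : ContDiff ℝ ∞ f) :
    multiDeriv e α (multiDeriv e β f) = multiDeriv e (α + β) f := by
  induction β using multiIndex_induction generalizing f with
  | zero => rw [multiDeriv_zero, add_zero]
  | step β j ih =>
    rw [multiDeriv_add_single e β j hf, ih (hf.dirDeriv _), ← add_assoc,
      multiDeriv_add_single e _ j hf]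

theorem multiDeriv_fun_add (e : Fin n → E) (α : Fin n → ℕ) {f g : E → ℂ} (hf : ContDiff ℝ ∞ f)
    (hg : ContDiff ℝ ∞ g) :
    multiDeriv e α (fun x => f x + g x) = fun x => multiDeriv e α f x + multiDeriv e α g x := by
  ext x
  have h : (fun x => f x + g x) = f + g := rfl
  unfold multiDeriv
  rw [h, iteratedFDeriv_add (hf.of_le (by exact_mod_cast le_top))
    (hg.of_le (by exact_mod_cast le_top))]
  rfl

theorem multiDeriv_const_mul (e : Fin n → E) (α : Fin n → ℕ) (c : ℂ) {f : E → ℂ}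
    (hf : ContDiff ℝ ∞ f) :
    multiDeriv e α (fun x => c * f x) = fun x => c * multiDeriv e α f x := by
  ext x
  have h : (fun x => c * f x) = c • f := rfl
  unfold multiDeriv
  rw [h, iteratedFDeriv_const_smul_apply (hf.of_le (by exact_mod_cast le_top)).contDiffAt]
  rfl

end MultiDeriv

noncomputable section

variable {d : ℕ}

/-- The Euclidean space `ℝ^d`. -/
abbrev Euc (d : ℕ) : Type := EuclideanSpace ℝ (Fin d)


/-! ### Symbols and the elementary operations on symbols and Schwartz functions -/

/-- Smooth symbols on phase space all of whose derivatives are bounded. -/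
structure IsSymbol (σ : Euc d × Euc d → ℂ) : Prop where
  contDiff : ContDiff ℝ ∞ σ
  bounded_multiDeriv : ∀ α, ∃ C, ∀ z, ‖multiDeriv (stdBasisPhase d) α σ z‖ ≤ C

theorem IsSymbol.dirDeriv {σ : Euc d × Euc d → ℂ} (hσ : IsSymbol σ) (k : Fin (d + d)) :
    IsSymbol (dirDeriv (stdBasisPhase d k) σ) where
  contDiff := hσ.contDiff.dirDeriv _
  bounded_multiDeriv α := by
    rw [← multiDeriv_add_single _ α k hσ.contDiff]
    exact hσ.bounded_multiDeriv _

theorem IsSymbol.bounded {σ : Euc d × Euc d → ℂ} (hσ : IsSymbol σ) : ∃ C, ∀ z, ‖σ z‖ ≤ C := by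
  simpa [multiDeriv_zero] using hσ.bounded_multiDeriv 0

/-- The partial derivative of a symbol in the `j`-th position variable. -/
def posDeriv (j : Fin d) (σ : Euc d × Euc d → ℂ) : Euc d × Euc d → ℂ :=
  dirDeriv (stdBasisPhase d (Fin.castAdd d j)) σ

/-- The partial derivative of a symbol in the `j`-th frequency variable. -/
def freqDeriv (j : Fin d) (σ : Euc d × Euc d → ℂ) : Euc d × Euc d → ℂ :=
  dirDeriv (stdBasisPhase d (Fin.natAdd d j)) σ

theorem posDeriv_apply (j : Fin d) (σ : Euc d × Euc d → ℂ) (z : Euc d × Euc d) :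
    posDeriv j σ z = fderiv ℝ σ z (stdBasis d j, 0) := by
  simp [posDeriv, dirDeriv, stdBasisPhase]

theorem freqDeriv_apply (j : Fin d) (σ : Euc d × Euc d → ℂ) (z : Euc d × Euc d) :
    freqDeriv j σ z = fderiv ℝ σ z (0, stdBasis d j) := by
  rw [freqDeriv, dirDeriv, stdBasisPhase, Fin.append_right]

theorem IsSymbol.posDeriv {σ : Euc d × Euc d → ℂ} (hσ : IsSymbol σ) (j : Fin d) :
    IsSymbol (posDeriv j σ) := hσ.dirDeriv _

theorem IsSymbol.freqDeriv {σ : Euc d × Euc d → ℂ} (hσ : IsSymbol σ) (j : Fin d) :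
    IsSymbol (freqDeriv j σ) := hσ.dirDeriv _

/-- The partial derivative `∂_j` on Schwartz functions. -/
def coordDeriv (j : Fin d) (f : 𝓢(Euc d, ℂ)) : 𝓢(Euc d, ℂ) :=
  LineDeriv.lineDerivOp (stdBasis d j) f

theorem coe_coordDeriv (j : Fin d) (f : 𝓢(Euc d, ℂ)) :
    ⇑(coordDeriv j f) = dirDeriv (stdBasis d j) f := by
  ext x
  exact SchwartzMap.lineDerivOp_apply_eq_fderiv _ _ _

theorem hasTemperateGrowth_coord (j : Fin d) :
    Function.HasTemperateGrowth (fun x : Euc d => ((x j : ℝ) : ℂ)) :=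
  (Complex.ofRealCLM.comp (EuclideanSpace.proj j : Euc d →L[ℝ] ℝ)).hasTemperateGrowth

/-- Multiplication of Schwartz functions by the `j`-th coordinate. -/
def coordMul (j : Fin d) (f : 𝓢(Euc d, ℂ)) : 𝓢(Euc d, ℂ) :=
  SchwartzMap.smulLeftCLM ℂ (fun x : Euc d => ((x j : ℝ) : ℂ)) f

theorem coordMul_apply (j : Fin d) (f : 𝓢(Euc d, ℂ)) (x : Euc d) :
    coordMul j f x = x j * f x :=
  SchwartzMap.smulLeftCLM_apply_apply (hasTemperateGrowth_coord j) f x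

theorem inner_stdBasis_left (j : Fin d) (x : Euc d) : inner ℝ (stdBasis d j) x = x j := by
  simp [stdBasis, EuclideanSpace.inner_single_left]

theorem inner_stdBasis_right (j : Fin d) (x : Euc d) : inner ℝ x (stdBasis d j) = x j := by
  rw [real_inner_comm, inner_stdBasis_left]

/-! ### Differentiation of the Weyl integrand and of the inner integral -/

theorem norm_weylIntegrand (σ : Euc d × Euc d → ℂ) (f : Euc d → ℂ) (x ξ y : Euc d) :
    ‖weylIntegrand σ f x ξ y‖ = ‖σ ((1 / 2 : ℝ) • (x + y), ξ)‖ * ‖f y‖ := by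
  have h : (2 * Real.pi * Complex.I * ((inner ℝ (x - y) ξ : ℝ) : ℂ)) =
      ((2 * Real.pi * inner ℝ (x - y) ξ : ℝ) : ℂ) * Complex.I := by
    push_cast; ring
  rw [weylIntegrand, norm_mul, norm_mul, h, Complex.norm_exp_ofReal_mul_I, one_mul]

/-- The total derivative of the Weyl integrand. -/
theorem exists_hasFDerivAt_weylIntegrand {σ : Euc d × Euc d → ℂ} (hσ : ContDiff ℝ ∞ σ)
    (f : 𝓢(Euc d, ℂ)) (x ξ y : Euc d) :
    ∃ L : (Euc d × Euc d × Euc d) →L[ℝ] ℂ,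
      HasFDerivAt (fun p : Euc d × Euc d × Euc d => weylIntegrand σ f p.1 p.2.1 p.2.2) L (x, ξ, y) ∧
      ∀ u v w, L (u, v, w) =
        2 * Real.pi * Complex.I * ((inner ℝ (u - w) ξ + inner ℝ (x - y) v : ℝ) : ℂ) *
          weylIntegrand σ f x ξ y +
        weylIntegrand (fun z => fderiv ℝ σ z ((1 / 2 : ℝ) • (u + w), v)) f x ξ y +
        weylIntegrand σ (dirDeriv w f) x ξ y := by
  let X : (Euc d × Euc d × Euc d) →L[ℝ] Euc d := .fst ℝ _ _
  let Ξ : (Euc d × Euc d × Euc d) →L[ℝ] Euc d := (ContinuousLinearMap.fst ℝ _ _).comp (.snd ℝ _ _)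
  let Y : (Euc d × Euc d × Euc d) →L[ℝ] Euc d := (ContinuousLinearMap.snd ℝ _ _).comp (.snd ℝ _ _)
  have h1 := ((X - Y).hasFDerivAt (x := (x, ξ, y))).inner ℝ Ξ.hasFDerivAt
  have h3 := ((Complex.ofRealCLM.hasFDerivAt.comp _ h1).const_mul
    (2 * Real.pi * Complex.I)).cexp
  have h5 := HasFDerivAt.comp (x, ξ, y)
    (hσ.differentiable (by simp) ((1 / 2 : ℝ) • (x + y), ξ)).hasFDerivAt
    (((1 / 2 : ℝ) • (X + Y)).prod Ξ).hasFDerivAt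
  have h6 := HasFDerivAt.comp (x, ξ, y) (f.hasFDerivAt y) Y.hasFDerivAt
  refine ⟨_, (h3.mul h5).mul h6, fun u v w => ?_⟩
  simp [weylIntegrand, dirDeriv, X, Ξ, Y]
  ring

/-- The inner integral of the Weyl operator, as a function on phase space. -/
def weylInner (σ : Euc d × Euc d → ℂ) (f : Euc d → ℂ) (z : Euc d × Euc d) : ℂ :=
  ∫ y, weylIntegrand σ f z.1 z.2 y

theorem continuous_weylIntegrand {σ : Euc d × Euc d → ℂ} (hσ : Continuous σ) {f : Euc d → ℂ}
    (hf : Continuous f) (x ξ : Euc d) : Continuous (weylIntegrand σ f x ξ) := by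
  unfold weylIntegrand
  fun_prop

theorem integrable_weylIntegrand {σ : Euc d × Euc d → ℂ} (hσ : IsSymbol σ) (f : 𝓢(Euc d, ℂ))
    (x ξ : Euc d) : Integrable (weylIntegrand σ f x ξ) := by
  obtain ⟨C, hC⟩ := hσ.bounded
  refine (f.integrable.norm.const_mul C).mono'
    (continuous_weylIntegrand hσ.contDiff.continuous f.continuous x ξ).aestronglyMeasurable ?_
  filter_upwards with y
  rw [norm_weylIntegrand]
  gcongr
  exact hC _

theorem weylIntegrand_const_mul_symbol (c : ℂ) (σ : Euc d × Euc d → ℂ) (f : Euc d → ℂ)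
    (x ξ y : Euc d) :
    weylIntegrand (fun z => c * σ z) f x ξ y = c * weylIntegrand σ f x ξ y := by
  simp only [weylIntegrand]; ring

theorem fderiv_half_eq_posDeriv (σ : Euc d × Euc d → ℂ) (j : Fin d) :
    (fun z => fderiv ℝ σ z ((1 / 2 : ℝ) • stdBasis d j, 0)) =
      fun z => (1 / 2 : ℂ) * posDeriv j σ z := by
  ext z
  have h : ((1 / 2 : ℝ) • stdBasis d j, (0 : Euc d)) = (1 / 2 : ℝ) • (stdBasis d j, (0 : Euc d)) := by
    rw [Prod.smul_mk, smul_zero]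
  rw [posDeriv_apply, h, map_smul, Complex.real_smul]
  norm_num

/-- The factor `1 / 2` on the symbol derivative comes from the midpoint `(x + y) / 2`; the same
factor appears for the derivative in `x`, and the two halves later add up to a full derivative. -/
theorem hasFDerivAt_weylIntegrand_right {σ : Euc d × Euc d → ℂ} (hσ : IsSymbol σ)
    (f : 𝓢(Euc d, ℂ)) (x ξ y : Euc d) :
    ∃ L : Euc d →L[ℝ] ℂ, HasFDerivAt (weylIntegrand σ f x ξ) L y ∧ ∀ j, L (stdBasis d j) =
      -(2 * Real.pi * Complex.I * ξ j) * weylIntegrand σ f x ξ y +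
        (1 / 2) * weylIntegrand (posDeriv j σ) f x ξ y +
        weylIntegrand σ (coordDeriv j f) x ξ y := by
  obtain ⟨L, hL, hLf⟩ := exists_hasFDerivAt_weylIntegrand hσ.contDiff f x ξ y
  have hι : HasFDerivAt (fun y : Euc d => (x, ξ, y))
      (ContinuousLinearMap.prod 0 (ContinuousLinearMap.prod 0 (.id ℝ _))) y :=
    (hasFDerivAt_const x y).prodMk ((hasFDerivAt_const ξ y).prodMk (hasFDerivAt_id y))
  have hc := HasFDerivAt.comp
    (g := fun p : Euc d × Euc d × Euc d => weylIntegrand σ f p.1 p.2.1 p.2.2) y hL hι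
  refine ⟨_, hc, fun j => ?_⟩
  have h : ∀ v : Euc d, (L.comp (ContinuousLinearMap.prod 0 (ContinuousLinearMap.prod 0 (.id ℝ _)))) v = L (0, 0, v) :=
    fun v => rfl
  rw [h, hLf, zero_add, fderiv_half_eq_posDeriv, weylIntegrand_const_mul_symbol, coe_coordDeriv,
    zero_sub, inner_neg_left, inner_stdBasis_left]
  simp

theorem hasFDerivAt_weylIntegrand_left {σ : Euc d × Euc d → ℂ} (hσ : IsSymbol σ)
    (f : 𝓢(Euc d, ℂ)) (z : Euc d × Euc d) (y : Euc d) :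
    ∃ L : Euc d × Euc d →L[ℝ] ℂ,
      HasFDerivAt (fun z : Euc d × Euc d => weylIntegrand σ f z.1 z.2 y) L z ∧
      (∀ j, L (stdBasis d j, 0) = 2 * Real.pi * Complex.I * z.2 j * weylIntegrand σ f z.1 z.2 y +
        (1 / 2) * weylIntegrand (posDeriv j σ) f z.1 z.2 y) ∧
      ∀ j, L (0, stdBasis d j) = 2 * Real.pi * Complex.I * z.1 j * weylIntegrand σ f z.1 z.2 y -
        2 * Real.pi * Complex.I * weylIntegrand σ (coordMul j f) z.1 z.2 y +
        weylIntegrand (freqDeriv j σ) f z.1 z.2 y := by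
  obtain ⟨L, hL, hLf⟩ := exists_hasFDerivAt_weylIntegrand hσ.contDiff f z.1 z.2 y
  have hι : HasFDerivAt (fun z : Euc d × Euc d => (z.1, z.2, y))
      (ContinuousLinearMap.prod (.fst ℝ _ _) (ContinuousLinearMap.prod (.snd ℝ _ _) 0)) z :=
    hasFDerivAt_fst.prodMk (hasFDerivAt_snd.prodMk (hasFDerivAt_const y z))
  have hc := HasFDerivAt.comp
    (g := fun p : Euc d × Euc d × Euc d => weylIntegrand σ f p.1 p.2.1 p.2.2) z hL hι
  refine ⟨_, hc, fun j => ?_, fun j => ?_⟩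
  · have h : ∀ v : Euc d, (L.comp (ContinuousLinearMap.prod (.fst ℝ _ _)
      (ContinuousLinearMap.prod (.snd ℝ _ _) 0))) (v, (0 : Euc d)) = L (v, 0, 0) := fun v => rfl
    rw [h, hLf, add_zero, fderiv_half_eq_posDeriv, weylIntegrand_const_mul_symbol, sub_zero,
      inner_stdBasis_left]
    simp [weylIntegrand, dirDeriv]
  · have h : ∀ v : Euc d, (L.comp (ContinuousLinearMap.prod (.fst ℝ _ _)
      (ContinuousLinearMap.prod (.snd ℝ _ _) 0))) ((0 : Euc d), v) = L (0, v, 0) := fun v => rfl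
    have h' : (fun p => fderiv ℝ σ p ((1 / 2 : ℝ) • (0 : Euc d), stdBasis d j)) =
        freqDeriv j σ := by
      ext p
      rw [smul_zero, freqDeriv_apply]
    rw [h, hLf, add_zero, h', sub_zero, inner_stdBasis_right]
    simp [weylIntegrand, dirDeriv, coordMul_apply]
    ring

/-- Integration by parts in the inner integral. -/
theorem freq_mul_weylInner {σ : Euc d × Euc d → ℂ} (hσ : IsSymbol σ) (f : 𝓢(Euc d, ℂ))
    (j : Fin d) (z : Euc d × Euc d) :
    2 * Real.pi * Complex.I * z.2 j * weylInner σ f z =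
      (1 / 2) * weylInner (posDeriv j σ) f z + weylInner σ (coordDeriv j f) z := by
  obtain ⟨x, ξ⟩ := z
  choose L hL hLf using fun y => hasFDerivAt_weylIntegrand_right hσ f x ξ y
  have hv : ∀ y, fderiv ℝ (weylIntegrand σ f x ξ) y (stdBasis d j) = _ := fun y => by
    rw [(hL y).fderiv, hLf]
  have i1 := (integrable_weylIntegrand hσ f x ξ).const_mul (-(2 * Real.pi * Complex.I * ξ j))
  have i2 := (integrable_weylIntegrand (hσ.posDeriv j) f x ξ).const_mul (1 / 2)
  have i3 := integrable_weylIntegrand hσ (coordDeriv j f) x ξ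
  -- Pairing with the constant function 1 turns integration by parts into the vanishing of the
  -- integral of an integrable directional derivative.
  have key := integral_mul_fderiv_eq_neg_fderiv_mul_of_integrable (μ := volume)
    (f := fun _ : Euc d => (1 : ℂ)) (g := weylIntegrand σ f x ξ) (v := stdBasis d j)
    (by simp) (by simp only [hv, one_mul]; exact (i1.add i2).add i3)
    (by simpa using integrable_weylIntegrand hσ f x ξ) (by simp)
    (fun y _ => (hL y).differentiableAt)
  simp only [hv, one_mul, fderiv_fun_const, Pi.zero_apply, zero_apply,
    zero_mul, integral_zero, neg_zero] at key
  have e1 := integral_add (i1.add i2) i3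
  have e2 := integral_add i1 i2
  simp only [Pi.add_apply] at e1 e2
  rw [e1, e2, integral_const_mul, integral_const_mul] at key
  simp only [weylInner]
  linear_combination -key

/-- The derivative of the Weyl integrand in the `j`-th position variable. -/
def weylPosPartial (σ : Euc d × Euc d → ℂ) (f : 𝓢(Euc d, ℂ)) (z : Euc d × Euc d) (j : Fin d)
    (y : Euc d) : ℂ :=
  2 * Real.pi * Complex.I * z.2 j * weylIntegrand σ f z.1 z.2 y +
    (1 / 2) * weylIntegrand (posDeriv j σ) f z.1 z.2 y

/-- The derivative of the Weyl integrand in the `j`-th frequency variable. -/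
def weylFreqPartial (σ : Euc d × Euc d → ℂ) (f : 𝓢(Euc d, ℂ)) (z : Euc d × Euc d) (j : Fin d)
    (y : Euc d) : ℂ :=
  2 * Real.pi * Complex.I * z.1 j * weylIntegrand σ f z.1 z.2 y -
    2 * Real.pi * Complex.I * weylIntegrand σ (coordMul j f) z.1 z.2 y +
    weylIntegrand (freqDeriv j σ) f z.1 z.2 y

/-- The `j`-th position coordinate on phase space. -/
def posCoord (j : Fin d) : (Euc d × Euc d) →L[ℝ] ℂ :=
  Complex.ofRealCLM.comp ((EuclideanSpace.proj j).comp (ContinuousLinearMap.fst ℝ _ _))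

/-- The `j`-th frequency coordinate on phase space. -/
def freqCoord (j : Fin d) : (Euc d × Euc d) →L[ℝ] ℂ :=
  Complex.ofRealCLM.comp ((EuclideanSpace.proj j).comp (ContinuousLinearMap.snd ℝ _ _))

/-- The derivative of the Weyl integrand in the phase space variables. -/
def weylIntegrandDeriv (σ : Euc d × Euc d → ℂ) (f : 𝓢(Euc d, ℂ)) (z : Euc d × Euc d)
    (y : Euc d) : (Euc d × Euc d) →L[ℝ] ℂ :=
  ∑ j, (weylPosPartial σ f z j y • posCoord j + weylFreqPartial σ f z j y • freqCoord j)

/-- The derivative is expanded in fixed coordinate functionals so that its integral over `y` can be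
computed coefficient by coefficient. -/
theorem hasFDerivAt_weylIntegrand {σ : Euc d × Euc d → ℂ} (hσ : IsSymbol σ) (f : 𝓢(Euc d, ℂ))
    (z : Euc d × Euc d) (y : Euc d) :
    HasFDerivAt (fun z : Euc d × Euc d => weylIntegrand σ f z.1 z.2 y)
      (weylIntegrandDeriv σ f z y) z := by
  obtain ⟨L, hL, hL1, hL2⟩ := hasFDerivAt_weylIntegrand_left hσ f z y
  suffices weylIntegrandDeriv σ f z y = L by rwa [this]
  have hb : ∀ j, (EuclideanSpace.basisFun (Fin d) ℝ).toBasis j = stdBasis d j := by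
    simp [stdBasis]
  refine ContinuousLinearMap.coe_injective (LinearMap.prod_ext ?_ ?_)
  · refine (EuclideanSpace.basisFun (Fin d) ℝ).toBasis.ext fun j => ?_
    rw [hb]
    refine Eq.trans ?_ (hL1 j).symm
    simp [weylIntegrandDeriv, weylPosPartial, weylFreqPartial, posCoord, freqCoord, stdBasis, apply_ite (Complex.ofReal)]
  · refine (EuclideanSpace.basisFun (Fin d) ℝ).toBasis.ext fun j => ?_
    rw [hb]
    refine Eq.trans ?_ (hL2 j).symm
    simp [weylIntegrandDeriv, weylPosPartial, weylFreqPartial, posCoord, freqCoord, stdBasis, apply_ite (Complex.ofReal)]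

section SumSMul

variable {ι X V : Type*} [Fintype ι] [MeasurableSpace X] {μ : Measure X} [NormedAddCommGroup V]
  [NormedSpace ℂ V] {A B : ι → X → ℂ}

theorem integrable_sum_smul_add_smul (hA : ∀ j, Integrable (A j) μ) (hB : ∀ j, Integrable (B j) μ)
    (P Q : ι → V) : Integrable (fun y => ∑ j, (A j y • P j + B j y • Q j)) μ :=
  integrable_finsetSum _ fun j _ => ((hA j).smul_const _).add ((hB j).smul_const _)

theorem integral_sum_smul_add_smul [CompleteSpace V] (hA : ∀ j, Integrable (A j) μ)
    (hB : ∀ j, Integrable (B j) μ) (P Q : ι → V) :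
    ∫ y, ∑ j, (A j y • P j + B j y • Q j) ∂μ =
      ∑ j, ((∫ y, A j y ∂μ) • P j + (∫ y, B j y ∂μ) • Q j) := by
  have h := integral_finsetSum (μ := μ) Finset.univ (f := fun j y => A j y • P j + B j y • Q j)
    fun j _ => ((hA j).smul_const (P j)).add ((hB j).smul_const (Q j))
  refine h.trans (Finset.sum_congr rfl fun j _ => ?_)
  refine (integral_add ((hA j).smul_const (P j)) ((hB j).smul_const (Q j))).trans ?_
  rw [integral_smul_const, integral_smul_const]

end SumSMul

theorem integrable_weylPosPartial {σ : Euc d × Euc d → ℂ} (hσ : IsSymbol σ) (f : 𝓢(Euc d, ℂ))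
    (z : Euc d × Euc d) (j : Fin d) : Integrable (weylPosPartial σ f z j) :=
  ((integrable_weylIntegrand hσ f z.1 z.2).const_mul _).add
    ((integrable_weylIntegrand (hσ.posDeriv j) f z.1 z.2).const_mul _)

/-- Integration by parts trades the factor `2πi ξ_j` for half a position derivative of the symbol
plus a derivative of `f`. No growth in `ξ` remains. -/
theorem integral_weylPosPartial {σ : Euc d × Euc d → ℂ} (hσ : IsSymbol σ) (f : 𝓢(Euc d, ℂ))
    (z : Euc d × Euc d) (j : Fin d) :
    ∫ y, weylPosPartial σ f z j y =
      weylInner (posDeriv j σ) f z + weylInner σ (coordDeriv j f) z := by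
  refine (integral_add ((integrable_weylIntegrand hσ f z.1 z.2).const_mul _)
    ((integrable_weylIntegrand (hσ.posDeriv j) f z.1 z.2).const_mul _)).trans ?_
  rw [integral_const_mul, integral_const_mul]
  have := freq_mul_weylInner hσ f j z
  simp only [weylInner] at this ⊢
  linear_combination this

theorem integrable_weylFreqPartial {σ : Euc d × Euc d → ℂ} (hσ : IsSymbol σ) (f : 𝓢(Euc d, ℂ))
    (z : Euc d × Euc d) (j : Fin d) : Integrable (weylFreqPartial σ f z j) :=
  (((integrable_weylIntegrand hσ f z.1 z.2).const_mul _).sub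
    ((integrable_weylIntegrand hσ (coordMul j f) z.1 z.2).const_mul _)).add
      (integrable_weylIntegrand (hσ.freqDeriv j) f z.1 z.2)

theorem integral_weylFreqPartial {σ : Euc d × Euc d → ℂ} (hσ : IsSymbol σ) (f : 𝓢(Euc d, ℂ))
    (z : Euc d × Euc d) (j : Fin d) :
    ∫ y, weylFreqPartial σ f z j y =
      2 * Real.pi * Complex.I * z.1 j * weylInner σ f z -
        2 * Real.pi * Complex.I * weylInner σ (coordMul j f) z + weylInner (freqDeriv j σ) f z := by
  have i1 := (integrable_weylIntegrand hσ f z.1 z.2).const_mul (2 * Real.pi * Complex.I * z.1 j)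
  have i2 := (integrable_weylIntegrand hσ (coordMul j f) z.1 z.2).const_mul
    (2 * Real.pi * Complex.I)
  refine (integral_add (i1.sub i2) (integrable_weylIntegrand (hσ.freqDeriv j) f z.1 z.2)).trans ?_
  have h := integral_sub i1 i2
  rw [integral_const_mul, integral_const_mul] at h
  simp only [weylInner]
  rw [← h]
  rfl

theorem integrable_weylIntegrandDeriv {σ : Euc d × Euc d → ℂ} (hσ : IsSymbol σ)
    (f : 𝓢(Euc d, ℂ)) (z : Euc d × Euc d) : Integrable (fun y => weylIntegrandDeriv σ f z y) := by
  exact integrable_sum_smul_add_smul (integrable_weylPosPartial hσ f z)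
    (integrable_weylFreqPartial hσ f z) posCoord freqCoord

theorem integral_weylIntegrandDeriv {σ : Euc d × Euc d → ℂ} (hσ : IsSymbol σ)
    (f : 𝓢(Euc d, ℂ)) (z : Euc d × Euc d) :
    ∫ y, weylIntegrandDeriv σ f z y =
      ∑ j, ((weylInner (posDeriv j σ) f z + weylInner σ (coordDeriv j f) z) • posCoord j +
        (2 * Real.pi * Complex.I * z.1 j * weylInner σ f z -
          2 * Real.pi * Complex.I * weylInner σ (coordMul j f) z + weylInner (freqDeriv j σ) f z) •
          freqCoord j) := by
  refine (integral_sum_smul_add_smul (integrable_weylPosPartial hσ f z)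
    (integrable_weylFreqPartial hσ f z) posCoord freqCoord).trans ?_
  simp only [integral_weylPosPartial hσ, integral_weylFreqPartial hσ]

theorem hasFDerivAt_weylInner {σ : Euc d × Euc d → ℂ} (hσ : IsSymbol σ) (f : 𝓢(Euc d, ℂ))
    (z : Euc d × Euc d) :
    HasFDerivAt (weylInner σ f) (∫ y, weylIntegrandDeriv σ f z y) z := by
  obtain ⟨C, hC⟩ := hσ.bounded
  choose Cp hCp using fun j => (hσ.posDeriv j).bounded
  choose Cf hCf using fun j => (hσ.freqDeriv j).bounded
  have hW : ∀ {τ : Euc d × Euc d → ℂ} {D : ℝ} (_ : ∀ z, ‖τ z‖ ≤ D) (g : Euc d → ℂ)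
      (w : Euc d × Euc d) (y : Euc d), ‖weylIntegrand τ g w.1 w.2 y‖ ≤ D * ‖g y‖ := by
    intro τ D hD g w y
    rw [norm_weylIntegrand]
    exact mul_le_mul_of_nonneg_right (hD _) (norm_nonneg _)
  have hC0 : 0 ≤ C := (norm_nonneg _).trans (hC 0)
  -- On the unit ball around `z` all coordinates of position and frequency are at most `R`, which
  -- gives a dominating function of `y` alone.
  let R : ℝ := ‖z‖ + 1
  let b : Euc d → ℝ := fun y => ∑ j,
    ((2 * Real.pi * R * (C * ‖f y‖) + 1 / 2 * (Cp j * ‖f y‖)) * ‖posCoord j‖ +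
      (2 * Real.pi * R * (C * ‖f y‖) + 2 * Real.pi * (C * ‖coordMul j f y‖) +
        Cf j * ‖f y‖) * ‖freqCoord j‖)
  refine hasFDerivAt_integral_of_dominated_of_fderiv_le (Metric.ball_mem_nhds z one_pos)
    (bound := b) (Filter.Eventually.of_forall fun w =>
      (integrable_weylIntegrand hσ f w.1 w.2).aestronglyMeasurable)
    (integrable_weylIntegrand hσ f z.1 z.2)
    (integrable_weylIntegrandDeriv hσ f z).aestronglyMeasurable
    (Filter.Eventually.of_forall fun y w hw => ?_) ?_
    (Filter.Eventually.of_forall fun y w _ => hasFDerivAt_weylIntegrand hσ f w y)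
  · have hwR : ‖w‖ ≤ R := by
      have := norm_le_norm_add_norm_sub' w z
      rw [Metric.mem_ball, dist_eq_norm] at hw
      simp only [R]; linarith
    have h1 : ∀ j, ‖((w.1 j : ℝ) : ℂ)‖ ≤ R := fun j => by
      rw [Complex.norm_real]
      exact (PiLp.norm_apply_le w.1 j).trans ((norm_fst_le w).trans hwR)
    have h2 : ∀ j, ‖((w.2 j : ℝ) : ℂ)‖ ≤ R := fun j => by
      rw [Complex.norm_real]
      exact (PiLp.norm_apply_le w.2 j).trans ((norm_snd_le w).trans hwR)
    have hpi : ‖(2 * Real.pi * Complex.I : ℂ)‖ = 2 * Real.pi := by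
      simp [abs_of_pos Real.pi_pos]
    have hR : 0 ≤ R := (norm_nonneg _).trans hwR
    have hpp := Real.pi_pos
    refine norm_sum_le_of_le _ fun j _ => (norm_add_le _ _).trans (add_le_add ?_ ?_)
    · rw [norm_smul]
      refine mul_le_mul_of_nonneg_right ((norm_add_le _ _).trans (add_le_add ?_ ?_)) (norm_nonneg _)
      · rw [norm_mul, norm_mul, hpi]
        gcongr
        exacts [h2 j, hW hC _ _ _]
      · rw [norm_mul]
        gcongr
        exacts [by norm_num, hW (hCp j) _ _ _]
    · rw [norm_smul]
      refine mul_le_mul_of_nonneg_right ((norm_add_le _ _).trans (add_le_add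
        ((norm_sub_le _ _).trans (add_le_add ?_ ?_)) (hW (hCf j) _ _ _))) (norm_nonneg _)
      · rw [norm_mul, norm_mul, hpi]
        gcongr
        exacts [h1 j, hW hC _ _ _]
      · rw [norm_mul, hpi]
        gcongr
        exact hW hC _ _ _
  · refine integrable_finsetSum _ fun j _ => ?_
    have i1 : Integrable (fun y => ‖f y‖) := f.integrable.norm
    have i2 : Integrable (fun y => ‖coordMul j f y‖) := (coordMul j f).integrable.norm
    exact ((((i1.const_mul _).const_mul _).add ((i1.const_mul _).const_mul _)).mul_const _).add
      (((((i1.const_mul _).const_mul _).add ((i2.const_mul _).const_mul _)).add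
        (i1.const_mul _)).mul_const _)

theorem continuous_weylInner {σ : Euc d × Euc d → ℂ} (hσ : IsSymbol σ) (f : 𝓢(Euc d, ℂ)) :
    Continuous (weylInner σ f) :=
  continuous_iff_continuousAt.2 fun z => (hasFDerivAt_weylInner hσ f z).continuousAt

/-! ### Decay of the inner integral and the sup-norm estimate -/

/-- `S` bounds all derivatives of order at most `m` of the symbol `σ`. -/
def SymbolBound (m : ℕ) (σ : Euc d × Euc d → ℂ) (S : ℝ) : Prop :=
  ∀ κ, ∑ i, κ i ≤ m → ∀ z, ‖multiDeriv (stdBasisPhase d) κ σ z‖ ≤ S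

/-- `F` bounds all derivatives of order at most `m` of `f`, with the weight
`(1 + ‖y‖) ^ (d + 1)`. -/
def WeightedBound (m : ℕ) (f : Euc d → ℂ) (F : ℝ) : Prop :=
  ∀ κ, ∑ i, κ i ≤ m → ∀ y, (1 + ‖y‖) ^ (d + 1) * ‖multiDeriv (stdBasis d) κ f y‖ ≤ F

theorem SymbolBound.of_le {m k : ℕ} {σ : Euc d × Euc d → ℂ} {S : ℝ} (h : SymbolBound m σ S)
    (hk : k ≤ m) : SymbolBound k σ S := fun κ hκ => h κ (hκ.trans hk)

theorem WeightedBound.of_le {m k : ℕ} {f : Euc d → ℂ} {F : ℝ} (h : WeightedBound m f F)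
    (hk : k ≤ m) : WeightedBound k f F := fun κ hκ => h κ (hκ.trans hk)

theorem SymbolBound.dirDeriv {m : ℕ} {σ : Euc d × Euc d → ℂ} {S : ℝ}
    (h : SymbolBound (m + 1) σ S) (hσ : ContDiff ℝ ∞ σ) (k : Fin (d + d)) :
    SymbolBound m (dirDeriv (stdBasisPhase d k) σ) S := fun κ hκ => by
  rw [← multiDeriv_add_single _ κ k hσ]
  exact h _ (by simpa [Finset.sum_add_distrib] using hκ)

theorem WeightedBound.coordDeriv {m : ℕ} {f : 𝓢(Euc d, ℂ)} {F : ℝ}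
    (h : WeightedBound (m + 1) f F) (j : Fin d) : WeightedBound m (coordDeriv j f) F :=
  fun κ hκ => by
    rw [coe_coordDeriv, ← multiDeriv_add_single _ κ j (f.smooth ⊤)]
    exact h _ (by simpa [Finset.sum_add_distrib] using hκ)

theorem SymbolBound.nonneg {m : ℕ} {σ : Euc d × Euc d → ℂ} {S : ℝ} (h : SymbolBound m σ S) :
    0 ≤ S := (norm_nonneg _).trans (h 0 (by simp) 0)

theorem SymbolBound.norm_le {m : ℕ} {σ : Euc d × Euc d → ℂ} {S : ℝ} (h : SymbolBound m σ S)
    (z : Euc d × Euc d) : ‖σ z‖ ≤ S := by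
  simpa [multiDeriv_zero] using h 0 (by simp) z

theorem WeightedBound.norm_le {m : ℕ} {f : Euc d → ℂ} {F : ℝ} (h : WeightedBound m f F)
    (y : Euc d) : ‖f y‖ ≤ F * ((1 + ‖y‖) ^ (d + 1))⁻¹ := by
  have h1 : (1 + ‖y‖) ^ (d + 1) * ‖f y‖ ≤ F := by
    simpa [multiDeriv_zero] using h 0 (by simp) y
  rw [← div_eq_mul_inv, le_div_iff₀ (by positivity), mul_comm]
  exact h1

theorem finite_multiIndex_le (n m : ℕ) : {κ : Fin n → ℕ | ∑ i, κ i ≤ m}.Finite :=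
  (Set.finite_Iic (fun _ : Fin n => m)).subset fun _ hκ i =>
    (Finset.single_le_sum (fun _ _ => Nat.zero_le _) (Finset.mem_univ i)).trans hκ

theorem IsSymbol.exists_symbolBound {σ : Euc d × Euc d → ℂ} (hσ : IsSymbol σ) (m : ℕ) :
    ∃ S, SymbolBound m σ S := by
  choose C hC using hσ.bounded_multiDeriv
  refine ⟨∑ κ ∈ (finite_multiIndex_le (d + d) m).toFinset, C κ, fun κ hκ z => (hC κ z).trans ?_⟩
  exact Finset.single_le_sum (fun κ _ => (norm_nonneg _).trans (hC κ 0)) (by simpa using hκ)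

theorem exists_coe_eq_multiDeriv (κ : Fin d → ℕ) (f : 𝓢(Euc d, ℂ)) :
    ∃ g : 𝓢(Euc d, ℂ), ⇑g = multiDeriv (stdBasis d) κ f := by
  induction κ using multiIndex_induction generalizing f with
  | zero => exact ⟨f, (multiDeriv_zero _ _).symm⟩
  | step κ j ih =>
    rw [multiDeriv_add_single _ κ j (f.smooth ⊤), ← coe_coordDeriv]
    exact ih _

theorem exists_weightedBound (f : 𝓢(Euc d, ℂ)) (m : ℕ) : ∃ F, WeightedBound m f F := by
  have h : ∀ κ, ∃ C, ∀ y, (1 + ‖y‖) ^ (d + 1) * ‖multiDeriv (stdBasis d) κ f y‖ ≤ C := by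
    intro κ
    obtain ⟨g, hg⟩ := exists_coe_eq_multiDeriv κ f
    have h := SchwartzMap.one_add_le_sup_seminorm_apply (𝕜 := ℝ) (m := (d + 1, 0)) le_rfl le_rfl g
    simp only [norm_iteratedFDeriv_zero, hg] at h
    exact ⟨_, h⟩
  choose C hC using h
  refine ⟨∑ κ ∈ (finite_multiIndex_le d m).toFinset, C κ, fun κ hκ z => (hC κ z).trans ?_⟩
  exact Finset.single_le_sum (fun κ _ => le_trans (by positivity) (hC κ 0)) (by simpa using hκ)

theorem integrable_weight (d : ℕ) : Integrable (fun y : Euc d => ((1 + ‖y‖) ^ (d + 1))⁻¹) := by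
  have := integrable_one_add_norm (E := Euc d) (μ := volume) (r := d + 1) (by simp)
  refine this.congr (Filter.Eventually.of_forall fun y => ?_)
  simp only
  rw [Real.rpow_neg (by positivity)]
  norm_cast

theorem norm_le_sum_abs (x : Euc d) : ‖x‖ ≤ ∑ j, |x j| := by
  have h : x = ∑ j, x j • stdBasis d j := by
    ext i
    simp [stdBasis, Pi.single_apply]
  conv_lhs => rw [h]
  refine norm_sum_le_of_le _ fun j _ => ?_
  simp [norm_smul, stdBasis]

/-- Rapid decay of the inner integral in the frequency variable. -/
theorem exists_weylInner_decay (d m : ℕ) : ∃ K, 0 ≤ K ∧ ∀ (σ : Euc d × Euc d → ℂ) (f : 𝓢(Euc d, ℂ))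
    (S F : ℝ), IsSymbol σ → SymbolBound m σ S → WeightedBound m f F →
      ∀ z, (1 + ‖z.2‖) ^ m * ‖weylInner σ f z‖ ≤ K * (S * F) := by
  induction m with
  | zero =>
    refine ⟨∫ y : Euc d, ((1 + ‖y‖) ^ (d + 1))⁻¹, integral_nonneg fun y => by positivity,
      fun σ f S F hσ hS hF z => ?_⟩
    rw [pow_zero, one_mul]
    refine (norm_integral_le_of_norm_le ((integrable_weight d).const_mul (S * F))
      (Filter.Eventually.of_forall fun y => ?_)).trans_eq ?_
    · rw [norm_weylIntegrand, mul_assoc]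
      exact mul_le_mul (hS.norm_le _) (hF.norm_le y) (norm_nonneg _) hS.nonneg
    · rw [integral_const_mul, mul_comm]
  | succ m ih =>
    obtain ⟨K, hK, h⟩ := ih
    refine ⟨K * (1 + d), by positivity, fun σ f S F hσ hS hF z => ?_⟩
    have h0 := h σ f S F hσ (hS.of_le m.le_succ) (hF.of_le m.le_succ) z
    have hj : ∀ j, (1 + ‖z.2‖) ^ m * (|z.2 j| * ‖weylInner σ f z‖) ≤ K * (S * F) := by
      intro j
      have h1 := h (posDeriv j σ) f S F (hσ.posDeriv j) (hS.dirDeriv hσ.contDiff _)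
        (hF.of_le m.le_succ) z
      have h2 := h σ (coordDeriv j f) S F hσ (hS.of_le m.le_succ) (hF.coordDeriv j) z
      have h3 := congrArg norm (freq_mul_weylInner hσ f j z)
      have h4 := norm_add_le ((1 / 2) * weylInner (posDeriv j σ) f z)
        (weylInner σ (coordDeriv j f) z)
      rw [← h3] at h4
      simp only [norm_mul, Complex.norm_real, Complex.norm_I, Real.norm_eq_abs,
        abs_of_pos Real.pi_pos] at h4
      norm_num at h4
      have hp : (0 : ℝ) < (1 + ‖z.2‖) ^ m := by positivity
      have h5 := mul_le_mul_of_nonneg_left h4 hp.le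
      have h6 : 0 ≤ (1 + ‖z.2‖) ^ m * (|z.2 j| * ‖weylInner σ f z‖) := by positivity
      -- The identity bounds `2π |ξ_j| |weylInner σ f z|`, with the weight, by `(1/2 + 1) K S F`,
      -- and `3/2 ≤ 2π`.
      nlinarith [Real.pi_gt_three]
    calc (1 + ‖z.2‖) ^ (m + 1) * ‖weylInner σ f z‖
        ≤ (1 + ‖z.2‖) ^ m * (1 + ∑ j, |z.2 j|) * ‖weylInner σ f z‖ := by
          rw [pow_succ]; gcongr; exact norm_le_sum_abs _
      _ = (1 + ‖z.2‖) ^ m * ‖weylInner σ f z‖ +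
          ∑ j, (1 + ‖z.2‖) ^ m * (|z.2 j| * ‖weylInner σ f z‖) := by
          rw [← Finset.mul_sum, ← Finset.sum_mul]; ring
      _ ≤ K * (S * F) + ∑ _j : Fin d, K * (S * F) := add_le_add h0 (Finset.sum_le_sum fun j _ => hj j)
      _ = K * (1 + d) * (S * F) := by simp; ring

theorem weylOperator_eq_integral_weylInner (σ : Euc d × Euc d → ℂ) (f : Euc d → ℂ) (x : Euc d) :
    weylOperator σ f x = ∫ ξ, weylInner σ f (x, ξ) := rfl

theorem exists_norm_weylInner_le (d : ℕ) : ∃ K, 0 ≤ K ∧ ∀ (σ : Euc d × Euc d → ℂ)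
    (f : 𝓢(Euc d, ℂ)) (S F : ℝ), IsSymbol σ → SymbolBound (d + 1) σ S →
      WeightedBound (d + 1) f F →
      ∀ x ξ, ‖weylInner σ f (x, ξ)‖ ≤ K * (S * F) * ((1 + ‖ξ‖) ^ (d + 1))⁻¹ := by
  obtain ⟨K, hK, h⟩ := exists_weylInner_decay d (d + 1)
  refine ⟨K, hK, fun σ f S F hσ hS hF x ξ => ?_⟩
  rw [← div_eq_mul_inv, le_div_iff₀ (by positivity), mul_comm]
  exact h σ f S F hσ hS hF (x, ξ)

theorem IsSymbol.exists_norm_weylInner_le {σ : Euc d × Euc d → ℂ} (hσ : IsSymbol σ)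
    (f : 𝓢(Euc d, ℂ)) :
    ∃ C, ∀ x ξ, ‖weylInner σ f (x, ξ)‖ ≤ C * ((1 + ‖ξ‖) ^ (d + 1))⁻¹ := by
  obtain ⟨K, -, h⟩ := _root_.exists_norm_weylInner_le d
  obtain ⟨S, hS⟩ := hσ.exists_symbolBound (d + 1)
  obtain ⟨F, hF⟩ := exists_weightedBound f (d + 1)
  exact ⟨_, h σ f S F hσ hS hF⟩

theorem integrable_weylInner {σ : Euc d × Euc d → ℂ} (hσ : IsSymbol σ) (f : 𝓢(Euc d, ℂ))
    (x : Euc d) : Integrable (fun ξ => weylInner σ f (x, ξ)) := by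
  obtain ⟨C, hC⟩ := hσ.exists_norm_weylInner_le f
  exact ((integrable_weight d).const_mul C).mono'
    ((continuous_weylInner hσ f).comp (by fun_prop)).aestronglyMeasurable
    (Filter.Eventually.of_forall fun ξ => hC x ξ)

/-- The sup-norm estimate for the Weyl operator. -/
theorem exists_norm_weylOperator_le (d : ℕ) : ∃ K, 0 ≤ K ∧ ∀ (σ : Euc d × Euc d → ℂ)
    (f : 𝓢(Euc d, ℂ)) (S F : ℝ), IsSymbol σ → SymbolBound (d + 1) σ S →
      WeightedBound (d + 1) f F → ∀ x, ‖weylOperator σ f x‖ ≤ K * (S * F) := by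
  obtain ⟨K, hK, h⟩ := exists_norm_weylInner_le d
  refine ⟨K * ∫ ξ : Euc d, ((1 + ‖ξ‖) ^ (d + 1))⁻¹,
    mul_nonneg hK (integral_nonneg fun y => by positivity), fun σ f S F hσ hS hF x => ?_⟩
  refine (norm_integral_le_of_norm_le ((integrable_weight d).const_mul _)
    (Filter.Eventually.of_forall fun ξ => h σ f S F hσ hS hF x ξ)).trans_eq ?_
  rw [integral_const_mul]
  ring

/-! ### Commutation of the Weyl operator with derivatives and coordinates -/

/-- The derivative of a function on `ℝ^d`, given by its partial derivatives. -/
def gradientCLM (a : Fin d → ℂ) : Euc d →L[ℝ] ℂ :=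
  ∑ j, a j • (Complex.ofRealCLM.comp (EuclideanSpace.proj j : Euc d →L[ℝ] ℝ))

theorem gradientCLM_stdBasis (a : Fin d → ℂ) (j : Fin d) : gradientCLM a (stdBasis d j) = a j := by
  simp [gradientCLM, stdBasis, apply_ite (Complex.ofReal)]

theorem hasFDerivAt_weylInner_fst {σ : Euc d × Euc d → ℂ} (hσ : IsSymbol σ) (f : 𝓢(Euc d, ℂ))
    (x ξ : Euc d) :
    HasFDerivAt (fun x => weylInner σ f (x, ξ))
      (gradientCLM fun j => weylInner (posDeriv j σ) f (x, ξ) + weylInner σ (coordDeriv j f) (x, ξ))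
      x := by
  have hι : HasFDerivAt (fun x : Euc d => (x, ξ)) (ContinuousLinearMap.inl ℝ (Euc d) (Euc d)) x :=
    hasFDerivAt_prodMk_left x ξ
  have h := HasFDerivAt.comp (g := weylInner σ f) x (hasFDerivAt_weylInner hσ f (x, ξ)) hι
  rw [integral_weylIntegrandDeriv hσ] at h
  refine h.congr_fderiv (ContinuousLinearMap.ext fun v => ?_)
  simp [gradientCLM, posCoord, freqCoord]

theorem hasFDerivAt_weylInner_snd {σ : Euc d × Euc d → ℂ} (hσ : IsSymbol σ) (f : 𝓢(Euc d, ℂ))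
    (x ξ : Euc d) :
    HasFDerivAt (fun ξ => weylInner σ f (x, ξ))
      (gradientCLM fun j => 2 * Real.pi * Complex.I * x j * weylInner σ f (x, ξ) -
        2 * Real.pi * Complex.I * weylInner σ (coordMul j f) (x, ξ) +
        weylInner (freqDeriv j σ) f (x, ξ)) ξ := by
  have hι : HasFDerivAt (fun ξ : Euc d => (x, ξ)) (ContinuousLinearMap.inr ℝ (Euc d) (Euc d)) ξ :=
    hasFDerivAt_prodMk_right x ξ
  have h := HasFDerivAt.comp (g := weylInner σ f) ξ (hasFDerivAt_weylInner hσ f (x, ξ)) hι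
  rw [integral_weylIntegrandDeriv hσ] at h
  refine h.congr_fderiv (ContinuousLinearMap.ext fun v => ?_)
  simp [gradientCLM, posCoord, freqCoord]

theorem integrable_sum_smul {ι X V : Type*} [Fintype ι] [MeasurableSpace X] {μ : Measure X}
    [NormedAddCommGroup V] [NormedSpace ℂ V] {A : ι → X → ℂ} (hA : ∀ j, Integrable (A j) μ)
    (P : ι → V) : Integrable (fun y => ∑ j, A j y • P j) μ :=
  integrable_finsetSum _ fun j _ => (hA j).smul_const _

theorem integral_gradientCLM {X : Type*} [MeasurableSpace X] {μ : Measure X}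
    {A : Fin d → X → ℂ} (hA : ∀ j, Integrable (A j) μ) :
    ∫ y, gradientCLM (fun j => A j y) ∂μ = gradientCLM fun j => ∫ y, A j y ∂μ := by
  have h := integral_sum_smul_add_smul hA (fun _ => integrable_zero _ _ _)
    (fun j => Complex.ofRealCLM.comp (EuclideanSpace.proj j : Euc d →L[ℝ] ℝ)) 0
  simpa [gradientCLM] using h

theorem hasFDerivAt_weylOperator {σ : Euc d × Euc d → ℂ} (hσ : IsSymbol σ) (f : 𝓢(Euc d, ℂ))
    (x : Euc d) :
    HasFDerivAt (weylOperator σ f)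
      (gradientCLM fun j => weylOperator (posDeriv j σ) f x + weylOperator σ (coordDeriv j f) x)
      x := by
  choose Cp hCp using fun j => (hσ.posDeriv j).exists_norm_weylInner_le f
  choose Cf hCf using fun j => hσ.exists_norm_weylInner_le (coordDeriv j f)
  have hi := fun x j => (integrable_weylInner (hσ.posDeriv j) f x).add
    (integrable_weylInner hσ (coordDeriv j f) x)
  have hint : (gradientCLM fun j => weylOperator (posDeriv j σ) f x +
      weylOperator σ (coordDeriv j f) x) = ∫ ξ, gradientCLM fun j =>
        weylInner (posDeriv j σ) f (x, ξ) + weylInner σ (coordDeriv j f) (x, ξ) := by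
    refine Eq.trans ?_ (integral_gradientCLM (hi x)).symm
    congr 1
    ext j
    exact (integral_add (integrable_weylInner (hσ.posDeriv j) f x)
      (integrable_weylInner hσ (coordDeriv j f) x)).symm
  rw [hint]
  let p : Fin d → Euc d →L[ℝ] ℂ := fun j =>
    Complex.ofRealCLM.comp (EuclideanSpace.proj j : Euc d →L[ℝ] ℝ)
  -- The decay in `ξ` is uniform in `x`, so the whole space serves as the neighbourhood.
  refine hasFDerivAt_integral_of_dominated_of_fderiv_le Filter.univ_mem
    (bound := fun ξ => ∑ j, (Cp j * ((1 + ‖ξ‖) ^ (d + 1))⁻¹ +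
      Cf j * ((1 + ‖ξ‖) ^ (d + 1))⁻¹) * ‖p j‖)
    (Filter.Eventually.of_forall fun w => (integrable_weylInner hσ f w).aestronglyMeasurable)
    (integrable_weylInner hσ f x) (integrable_sum_smul (hi x) p).aestronglyMeasurable
    (Filter.Eventually.of_forall fun ξ w _ => ?_) ?_
    (Filter.Eventually.of_forall fun ξ w _ => hasFDerivAt_weylInner_fst hσ f w ξ)
  · refine norm_sum_le_of_le _ fun j _ => ?_
    rw [norm_smul]
    exact mul_le_mul_of_nonneg_right
      ((norm_add_le _ _).trans (add_le_add (hCp j w ξ) (hCf j w ξ))) (norm_nonneg _)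
  · exact integrable_finsetSum _ fun j _ =>
      (((integrable_weight d).const_mul _).add ((integrable_weight d).const_mul _)).mul_const _

theorem dirDeriv_weylOperator {σ : Euc d × Euc d → ℂ} (hσ : IsSymbol σ) (f : 𝓢(Euc d, ℂ))
    (j : Fin d) :
    dirDeriv (stdBasis d j) (weylOperator σ f) =
      fun x => weylOperator (posDeriv j σ) f x + weylOperator σ (coordDeriv j f) x := by
  ext x
  rw [dirDeriv, (hasFDerivAt_weylOperator hσ f x).fderiv, gradientCLM_stdBasis]

/-- The integral over `ξ` of the `ξ_j`-derivative of the inner integral vanishes. That derivative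
produces `2πi (x_j - y_j)` from the phase, with `y_j` absorbed into `f`, and a frequency derivative
of the symbol. -/
theorem coord_mul_weylOperator {σ : Euc d × Euc d → ℂ} (hσ : IsSymbol σ) (f : 𝓢(Euc d, ℂ))
    (j : Fin d) (x : Euc d) :
    x j * weylOperator σ f x = weylOperator σ (coordMul j f) x -
      (2 * Real.pi * Complex.I)⁻¹ * weylOperator (freqDeriv j σ) f x := by
  have i0 := integrable_weylInner hσ f x
  have i1 := i0.const_mul (2 * Real.pi * Complex.I * x j)
  have i2 := (integrable_weylInner hσ (coordMul j f) x).const_mul (2 * Real.pi * Complex.I)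
  have i3 := integrable_weylInner (hσ.freqDeriv j) f x
  have hv : ∀ ξ, fderiv ℝ (fun ξ => weylInner σ f (x, ξ)) ξ (stdBasis d j) = _ := fun ξ => by
    rw [(hasFDerivAt_weylInner_snd hσ f x ξ).fderiv, gradientCLM_stdBasis]
  have key := integral_mul_fderiv_eq_neg_fderiv_mul_of_integrable (μ := volume)
    (f := fun _ : Euc d => (1 : ℂ)) (g := fun ξ => weylInner σ f (x, ξ)) (v := stdBasis d j)
    (by simp) (by simp only [hv, one_mul]; exact (i1.sub i2).add i3)
    (by simpa using i0) (by simp)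
    (fun ξ _ => (hasFDerivAt_weylInner_snd hσ f x ξ).differentiableAt)
  simp only [hv, one_mul, fderiv_fun_const, Pi.zero_apply, zero_apply,
    zero_mul, integral_zero, neg_zero] at key
  have e1 := integral_add (i1.sub i2) i3
  have e2 := integral_sub i1 i2
  simp only [Pi.sub_apply] at e1 e2
  rw [e1, e2, integral_const_mul, integral_const_mul] at key
  simp only [weylOperator_eq_integral_weylInner]
  have hpi : (2 * Real.pi * Complex.I : ℂ) ≠ 0 := by
    simp [Real.pi_ne_zero]
  field_simp
  linear_combination key

theorem eq_gradientCLM (L : Euc d →L[ℝ] ℂ) : L = gradientCLM fun j => L (stdBasis d j) := by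
  have hb : ∀ j, (EuclideanSpace.basisFun (Fin d) ℝ).toBasis j = stdBasis d j := by
    simp [stdBasis]
  refine ContinuousLinearMap.coe_injective ((EuclideanSpace.basisFun (Fin d) ℝ).toBasis.ext
    fun j => ?_)
  rw [hb]
  exact (gradientCLM_stdBasis (fun j => L (stdBasis d j)) j).symm

theorem fderiv_eq_gradientCLM (g : Euc d → ℂ) :
    fderiv ℝ g = fun x => gradientCLM fun j => dirDeriv (stdBasis d j) g x :=
  funext fun x => eq_gradientCLM (fderiv ℝ g x)

/-- Applied to the coordinate functionals, this passes from decay of the partial derivatives to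
decay of the full derivative. The constants depend on `p` only. -/
theorem exists_norm_iteratedFDeriv_sum_smul_le {ι E V : Type*} [Fintype ι] [NormedAddCommGroup E]
    [NormedSpace ℝ E] [NormedAddCommGroup V] [NormedSpace ℂ V] [NormedSpace ℝ V]
    [IsScalarTower ℝ ℂ V] (p : ι → V) :
    ∃ c : ι → ℝ, (∀ j, 0 ≤ c j) ∧ ∀ (n : ℕ) (a : ι → E → ℂ), (∀ j, ContDiff ℝ n (a j)) →
      ∀ x, ‖iteratedFDeriv ℝ n (fun x => ∑ j, a j x • p j) x‖ ≤
        ∑ j, c j * ‖iteratedFDeriv ℝ n (a j) x‖ := by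
  let L : ι → ℂ →L[ℝ] V := fun j =>
    (ContinuousLinearMap.toSpanSingleton ℂ (p j)).restrictScalars ℝ
  refine ⟨fun j => ‖L j‖, fun j => norm_nonneg _, fun n a ha x => ?_⟩
  have h : (fun x => ∑ j, a j x • p j) = fun x => ∑ j, (L j ∘ a j) x := by
    ext x; simp [L]
  rw [h, iteratedFDeriv_fun_sum_apply fun j _ => ((L j).contDiff.comp (ha j)).contDiffAt]
  refine norm_sum_le_of_le _ fun j _ => ?_
  exact (L j).norm_iteratedFDeriv_comp_left (ha j).contDiffAt le_rfl

/-! ### The image of a Schwartz function is a Schwartz function -/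

section Closed

variable {V : Submodule ℂ (Euc d → ℂ)}

theorem contDiff_of_closed_dirDeriv (hdiff : ∀ g ∈ V, Differentiable ℝ g)
    (hderiv : ∀ g ∈ V, ∀ j, dirDeriv (stdBasis d j) g ∈ V) (n : ℕ) :
    ∀ g ∈ V, ContDiff ℝ n g := by
  induction n with
  | zero => exact fun g hg => contDiff_zero.2 (hdiff g hg).continuous
  | succ n ih =>
    intro g hg
    rw [Nat.cast_succ, contDiff_succ_iff_fderiv]
    refine ⟨hdiff g hg, by simp, ?_⟩
    rw [fderiv_eq_gradientCLM]
    exact ContDiff.sum fun j _ => (ih _ (hderiv g hg j)).smul contDiff_const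

theorem exists_norm_pow_mul_le_of_closed_mul (hbdd : ∀ g ∈ V, ∃ C, ∀ x, ‖g x‖ ≤ C)
    (hmul : ∀ g ∈ V, ∀ j, (fun x : Euc d => (x j : ℂ) * g x) ∈ V) (k : ℕ) :
    ∀ g ∈ V, ∃ C, ∀ x, ‖x‖ ^ k * ‖g x‖ ≤ C := by
  induction k with
  | zero => simpa using hbdd
  | succ k ih =>
    intro g hg
    choose C hC using fun j => ih _ (hmul g hg j)
    refine ⟨∑ j, C j, fun x => ?_⟩
    calc ‖x‖ ^ (k + 1) * ‖g x‖ ≤ ‖x‖ ^ k * (∑ j, |x j|) * ‖g x‖ := by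
          rw [pow_succ]; gcongr; exact norm_le_sum_abs x
      _ = ∑ j, ‖x‖ ^ k * ‖(x j : ℂ) * g x‖ := by
          rw [Finset.mul_sum, Finset.sum_mul]
          refine Finset.sum_congr rfl fun j _ => ?_
          rw [norm_mul, Complex.norm_real, Real.norm_eq_abs, mul_assoc]
      _ ≤ ∑ j, C j := Finset.sum_le_sum fun j _ => hC j x

/-- A space of bounded differentiable functions that is closed under partial derivatives and under
multiplication by the coordinates consists of Schwartz functions. -/
theorem exists_decay_of_closed (hbdd : ∀ g ∈ V, ∃ C, ∀ x, ‖g x‖ ≤ C)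
    (hdiff : ∀ g ∈ V, Differentiable ℝ g)
    (hderiv : ∀ g ∈ V, ∀ j, dirDeriv (stdBasis d j) g ∈ V)
    (hmul : ∀ g ∈ V, ∀ j, (fun x : Euc d => (x j : ℂ) * g x) ∈ V) (k n : ℕ) :
    ∀ g ∈ V, ∃ C, ∀ x, ‖x‖ ^ k * ‖iteratedFDeriv ℝ n g x‖ ≤ C := by
  induction n with
  | zero => simpa using exists_norm_pow_mul_le_of_closed_mul hbdd hmul k
  | succ n ih =>
    intro g hg
    choose C hC using fun j => ih _ (hderiv g hg j)
    obtain ⟨c, hc0, hc⟩ := exists_norm_iteratedFDeriv_sum_smul_le (E := Euc d)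
      fun j : Fin d => Complex.ofRealCLM.comp (EuclideanSpace.proj j : Euc d →L[ℝ] ℝ)
    refine ⟨∑ j, c j * C j, fun x => ?_⟩
    rw [← norm_iteratedFDeriv_fderiv, fderiv_eq_gradientCLM]
    refine (mul_le_mul_of_nonneg_left (hc n (fun j => dirDeriv (stdBasis d j) g)
      (fun j => contDiff_of_closed_dirDeriv hdiff hderiv n _ (hderiv g hg j)) x)
      (by positivity)).trans ?_
    rw [Finset.mul_sum]
    refine Finset.sum_le_sum fun j _ => ?_
    rw [mul_left_comm]
    exact mul_le_mul_of_nonneg_left (hC j x) (hc0 j)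

end Closed

/-- The span of the images of Schwartz functions under Weyl operators. -/
def weylSpan (d : ℕ) : Submodule ℂ (Euc d → ℂ) :=
  Submodule.span ℂ {g | ∃ (σ : Euc d × Euc d → ℂ) (f : 𝓢(Euc d, ℂ)), IsSymbol σ ∧
    g = weylOperator σ f}

theorem weylOperator_mem_weylSpan {σ : Euc d × Euc d → ℂ} (hσ : IsSymbol σ) (f : 𝓢(Euc d, ℂ)) :
    weylOperator σ f ∈ weylSpan d := Submodule.subset_span ⟨σ, f, hσ, rfl⟩

theorem differentiable_of_mem_weylSpan (g : Euc d → ℂ) (hg : g ∈ weylSpan d) :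
    Differentiable ℝ g := by
  induction hg using Submodule.span_induction with
  | mem g h =>
    obtain ⟨σ, f, hσ, rfl⟩ := h
    exact fun x => (hasFDerivAt_weylOperator hσ f x).differentiableAt
  | zero => exact differentiable_const 0
  | add g₁ g₂ _ _ h₁ h₂ => exact h₁.add h₂
  | smul c g _ h => exact h.const_smul c

theorem bounded_of_mem_weylSpan (g : Euc d → ℂ) (hg : g ∈ weylSpan d) :
    ∃ C, ∀ x, ‖g x‖ ≤ C := by
  induction hg using Submodule.span_induction with
  | mem g h =>
    obtain ⟨σ, f, hσ, rfl⟩ := h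
    obtain ⟨K, -, h⟩ := exists_norm_weylOperator_le d
    obtain ⟨S, hS⟩ := hσ.exists_symbolBound (d + 1)
    obtain ⟨F, hF⟩ := exists_weightedBound f (d + 1)
    exact ⟨_, h σ f S F hσ hS hF⟩
  | zero => exact ⟨0, by simp⟩
  | add g₁ g₂ _ _ h₁ h₂ =>
    obtain ⟨C₁, h₁⟩ := h₁
    obtain ⟨C₂, h₂⟩ := h₂
    exact ⟨C₁ + C₂, fun x => norm_add_le_of_le (h₁ x) (h₂ x)⟩
  | smul c g _ h =>
    obtain ⟨C, h⟩ := h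
    refine ⟨‖c‖ * C, fun x => ?_⟩
    rw [Pi.smul_apply, norm_smul]
    exact mul_le_mul_of_nonneg_left (h x) (norm_nonneg c)

theorem dirDeriv_mem_weylSpan (g : Euc d → ℂ) (hg : g ∈ weylSpan d) (j : Fin d) :
    dirDeriv (stdBasis d j) g ∈ weylSpan d := by
  induction hg using Submodule.span_induction with
  | mem g h =>
    obtain ⟨σ, f, hσ, rfl⟩ := h
    rw [dirDeriv_weylOperator hσ]
    exact add_mem (weylOperator_mem_weylSpan (hσ.posDeriv j) f) (weylOperator_mem_weylSpan hσ _)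
  | zero =>
    have h : dirDeriv (stdBasis d j) (0 : Euc d → ℂ) = 0 := by
      ext x; simp [dirDeriv]
    rw [h]
    exact zero_mem _
  | add g₁ g₂ m₁ m₂ h₁ h₂ =>
    have h : dirDeriv (stdBasis d j) (g₁ + g₂) =
        dirDeriv (stdBasis d j) g₁ + dirDeriv (stdBasis d j) g₂ := by
      ext x
      simp only [dirDeriv, Pi.add_apply]
      rw [fderiv_add (differentiable_of_mem_weylSpan _ m₁ x)
        (differentiable_of_mem_weylSpan _ m₂ x)]
      rfl
    rw [h]
    exact add_mem h₁ h₂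
  | smul c g m h =>
    have h' : dirDeriv (stdBasis d j) (c • g) = c • dirDeriv (stdBasis d j) g := by
      ext x
      simp only [dirDeriv, Pi.smul_apply]
      rw [fderiv_const_smul (differentiable_of_mem_weylSpan _ m x)]
      rfl
    rw [h']
    exact Submodule.smul_mem _ c h

theorem coord_mul_mem_weylSpan (g : Euc d → ℂ) (hg : g ∈ weylSpan d) (j : Fin d) :
    (fun x : Euc d => (x j : ℂ) * g x) ∈ weylSpan d := by
  induction hg using Submodule.span_induction with
  | mem g h =>
    obtain ⟨σ, f, hσ, rfl⟩ := h
    simp only [coord_mul_weylOperator hσ]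
    exact sub_mem (weylOperator_mem_weylSpan hσ (coordMul j f))
      (Submodule.smul_mem _ (2 * Real.pi * Complex.I : ℂ)⁻¹
        (weylOperator_mem_weylSpan (hσ.freqDeriv j) f))
  | zero =>
    simp only [Pi.zero_apply, mul_zero]
    exact zero_mem _
  | add g₁ g₂ _ _ h₁ h₂ =>
    simp only [Pi.add_apply, mul_add]
    exact add_mem h₁ h₂
  | smul c g _ h =>
    simp only [Pi.smul_apply, smul_eq_mul, mul_left_comm _ c]
    exact Submodule.smul_mem _ c h

/-- The image of a Schwartz function under a Weyl operator, as a Schwartz function. -/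
def weylSchwartz {σ : Euc d × Euc d → ℂ} (hσ : IsSymbol σ) (f : 𝓢(Euc d, ℂ)) : 𝓢(Euc d, ℂ) where
  toFun := weylOperator σ f
  smooth' := contDiff_infty.2 fun n => contDiff_of_closed_dirDeriv differentiable_of_mem_weylSpan
    dirDeriv_mem_weylSpan n _ (weylOperator_mem_weylSpan hσ f)
  decay' k n := exists_decay_of_closed bounded_of_mem_weylSpan differentiable_of_mem_weylSpan
    dirDeriv_mem_weylSpan coord_mul_mem_weylSpan k n _ (weylOperator_mem_weylSpan hσ f)

theorem coe_weylSchwartz {σ : Euc d × Euc d → ℂ} (hσ : IsSymbol σ) (f : 𝓢(Euc d, ℂ)) :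
    ⇑(weylSchwartz hσ f) = weylOperator σ f := rfl

theorem weylOperator_add {σ : Euc d × Euc d → ℂ} (hσ : IsSymbol σ) (f g : 𝓢(Euc d, ℂ))
    (x : Euc d) :
    weylOperator σ (f + g : 𝓢(Euc d, ℂ)) x = weylOperator σ f x + weylOperator σ g x := by
  have h : ∀ z, weylInner σ (f + g : 𝓢(Euc d, ℂ)) z = weylInner σ f z + weylInner σ g z := by
    intro z
    refine Eq.trans ?_ (integral_add (integrable_weylIntegrand hσ f z.1 z.2)
      (integrable_weylIntegrand hσ g z.1 z.2))
    simp [weylInner, weylIntegrand, mul_add]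
  simp only [weylOperator_eq_integral_weylInner, h]
  exact integral_add (integrable_weylInner hσ f x) (integrable_weylInner hσ g x)

theorem weylOperator_smul (σ : Euc d × Euc d → ℂ) (c : ℂ) (f : 𝓢(Euc d, ℂ)) (x : Euc d) :
    weylOperator σ (c • f : 𝓢(Euc d, ℂ)) x = c * weylOperator σ f x := by
  have h : ∀ z, weylInner σ (c • f : 𝓢(Euc d, ℂ)) z = c * weylInner σ f z := by
    intro z
    simp only [weylInner]
    rw [← integral_const_mul]
    simp [weylIntegrand, mul_left_comm]
  simp only [weylOperator_eq_integral_weylInner, h, integral_const_mul]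

/-! ### Monomials and their derivatives -/

/-- The monomial `x^α`, with complex values. -/
def monomialFun (α : Fin d → ℕ) (x : Euc d) : ℂ := ((∏ i, x i ^ α i : ℝ) : ℂ)

theorem monomialFun_zero (x : Euc d) : monomialFun 0 x = 1 := by simp [monomialFun]

theorem monomialFun_add_single (α : Fin d → ℕ) (j : Fin d) (x : Euc d) :
    monomialFun (α + Pi.single j 1) x = monomialFun α x * x j := by
  have h : ∀ i, x i ^ (α + Pi.single j 1 : Fin d → ℕ) i =
      x i ^ α i * (if i = j then x j else 1) := by
    intro i
    rcases eq_or_ne i j with rfl | hi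
    · simp [pow_succ]
    · simp [hi]
  simp only [monomialFun, h, Finset.prod_mul_distrib, Finset.prod_ite_eq', Finset.mem_univ,
    if_true, Complex.ofReal_mul]

theorem contDiff_coord (j : Fin d) : ContDiff ℝ ∞ (fun x : Euc d => ((x j : ℝ) : ℂ)) :=
  (Complex.ofRealCLM.comp (EuclideanSpace.proj j : Euc d →L[ℝ] ℝ)).contDiff

theorem contDiff_monomialFun (α : Fin d → ℕ) : ContDiff ℝ ∞ (monomialFun α) := by
  induction α using multiIndex_induction with
  | zero => rw [funext monomialFun_zero]; exact contDiff_const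
  | step α j ih => rw [funext (monomialFun_add_single α j)]; exact ih.mul (contDiff_coord j)

theorem dirDeriv_mul {E : Type*} [NormedAddCommGroup E] [NormedSpace ℝ E] {f g : E → ℂ}
    (hf : ContDiff ℝ ∞ f) (hg : ContDiff ℝ ∞ g) (v : E) :
    dirDeriv v (fun x => f x * g x) = fun x => dirDeriv v f x * g x + f x * dirDeriv v g x := by
  ext x
  simp only [dirDeriv]
  rw [fderiv_fun_mul (hf.differentiable (by simp) x) (hg.differentiable (by simp) x)]
  simp
  ring

theorem dirDeriv_coord (i j : Fin d) (x : Euc d) :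
    dirDeriv (stdBasis d j) (fun x : Euc d => ((x i : ℝ) : ℂ)) x = if i = j then 1 else 0 := by
  have h := (Complex.ofRealCLM.comp (EuclideanSpace.proj i : Euc d →L[ℝ] ℝ)).hasFDerivAt (x := x)
  change fderiv ℝ (Complex.ofRealCLM.comp (EuclideanSpace.proj i : Euc d →L[ℝ] ℝ)) x _ = _
  rw [h.fderiv]
  simp [stdBasis, apply_ite (Complex.ofReal)]

theorem dirDeriv_monomialFun (γ : Fin d → ℕ) (j : Fin d) (x : Euc d) :
    dirDeriv (stdBasis d j) (monomialFun γ) x = γ j * monomialFun (γ - Pi.single j 1) x := by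
  induction γ using multiIndex_induction with
  | zero =>
    rw [funext monomialFun_zero]
    simp [dirDeriv]
  | step γ i ih =>
    rw [funext (monomialFun_add_single γ i),
      dirDeriv_mul (contDiff_monomialFun γ) (contDiff_coord i)]
    simp only [ih, dirDeriv_coord]
    rcases eq_or_ne i j with rfl | hij
    · have h1 : (γ i : ℂ) * monomialFun (γ - Pi.single i 1) x * x i = γ i * monomialFun γ x := by
        rcases Nat.eq_zero_or_pos (γ i) with h0 | h0
        · simp [h0]
        · rw [mul_assoc, ← monomialFun_add_single]
          congr 2
          ext k
          rcases eq_or_ne k i with rfl | hk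
          · simp; omega
          · simp [hk]
      rw [h1, add_tsub_cancel_right]
      simp
      ring
    · have h1 : γ + Pi.single i 1 - Pi.single j 1 = γ - Pi.single j 1 + Pi.single i 1 := by
        ext k
        rcases eq_or_ne k j with rfl | hk
        · simp [hij.symm]
        · simp [hk]
      rw [h1, monomialFun_add_single]
      simp [hij, hij.symm]
      ring

/-! ### Iterated commutation: distributing `x^α ∂^β` between symbol and function -/

theorem append_add_single_left (δ γ : Fin d → ℕ) (j : Fin d) :
    Fin.append (δ + Pi.single j 1) γ = Fin.append δ γ + Pi.single (Fin.castAdd d j) 1 := by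
  ext k
  induction k using Fin.addCases with
  | left k => simp [Pi.single_apply]
  | right k =>
    have : Fin.natAdd d k ≠ Fin.castAdd d j := by
      intro h; have := congrArg Fin.val h; simp at this; omega
    rw [Pi.add_apply, Pi.single_apply, if_neg this, Fin.append_right, Fin.append_right, add_zero]

theorem append_add_single_right (δ γ : Fin d → ℕ) (j : Fin d) :
    Fin.append δ (γ + Pi.single j 1) = Fin.append δ γ + Pi.single (Fin.natAdd d j) 1 := by
  ext k
  induction k using Fin.addCases with
  | right k =>
    rw [Pi.add_apply, Pi.single_apply, Fin.append_right, Fin.append_right, Pi.add_apply,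
      Pi.single_apply]
    simp [Fin.ext_iff]
  | left k =>
    have : Fin.castAdd d k ≠ Fin.natAdd d j := by
      intro h; have := congrArg Fin.val h; simp at this; omega
    rw [Pi.add_apply, Pi.single_apply, if_neg this, Fin.append_left, Fin.append_left, add_zero]

theorem append_zero_zero : Fin.append (0 : Fin d → ℕ) (0 : Fin d → ℕ) = 0 := by
  ext k
  induction k using Fin.addCases with
  | left k => rw [Fin.append_left]; rfl
  | right k => rw [Fin.append_right]; rfl

/-- For all ways to split the operators `x^α ∂^β` between the symbol and the function, the product
of the bounds of the two resulting factors is at most `R`. -/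
def SplitBound (α β : Fin d → ℕ) (σ : Euc d × Euc d → ℂ) (f : Euc d → ℂ) (R : ℝ) : Prop :=
  ∀ γ γ' δ δ' : Fin d → ℕ, γ + γ' = α → δ + δ' = β → ∃ S F,
    SymbolBound (d + 1) (multiDeriv (stdBasisPhase d) (Fin.append δ γ) σ) S ∧
    WeightedBound (d + 1) (fun y => monomialFun γ' y * multiDeriv (stdBasis d) δ' f y) F ∧
    S * F ≤ R

theorem SplitBound.posDeriv {α β : Fin d → ℕ} {σ : Euc d × Euc d → ℂ} {f : Euc d → ℂ} {R : ℝ}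
    {j : Fin d} (h : SplitBound α (β + Pi.single j 1) σ f R) (hσ : IsSymbol σ) :
    SplitBound α β (posDeriv j σ) f R := by
  intro γ γ' δ δ' hγ hδ
  have := h γ γ' (δ + Pi.single j 1) δ' hγ (by rw [← hδ, add_right_comm])
  rwa [append_add_single_left, multiDeriv_add_single _ _ _ hσ.contDiff] at this

theorem SplitBound.coordDeriv {α β : Fin d → ℕ} {σ : Euc d × Euc d → ℂ} {f : 𝓢(Euc d, ℂ)} {R : ℝ}
    {j : Fin d} (h : SplitBound α (β + Pi.single j 1) σ f R) :
    SplitBound α β σ (coordDeriv j f) R := by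
  intro γ γ' δ δ' hγ hδ
  have := h γ γ' δ (δ' + Pi.single j 1) hγ (by rw [← hδ, add_assoc])
  rwa [multiDeriv_add_single _ _ _ (f.smooth ⊤), ← coe_coordDeriv] at this

theorem SplitBound.freqDeriv {α : Fin d → ℕ} {σ : Euc d × Euc d → ℂ} {f : Euc d → ℂ} {R : ℝ}
    {j : Fin d} (h : SplitBound (α + Pi.single j 1) 0 σ f R) (hσ : IsSymbol σ) :
    SplitBound α 0 (freqDeriv j σ) f R := by
  intro γ γ' δ δ' hγ hδ
  have := h (γ + Pi.single j 1) γ' δ δ' (by rw [← hγ, add_right_comm]) hδ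
  rwa [append_add_single_right, multiDeriv_add_single _ _ _ hσ.contDiff] at this

/-- With `β = 0` no derivative of `f` is left, so the new coordinate factor joins the monomial
directly, without a commutator with a derivative. -/
theorem SplitBound.coordMul {α : Fin d → ℕ} {σ : Euc d × Euc d → ℂ} {f : 𝓢(Euc d, ℂ)} {R : ℝ}
    {j : Fin d} (h : SplitBound (α + Pi.single j 1) 0 σ f R) :
    SplitBound α 0 σ (coordMul j f) R := by
  intro γ γ' δ δ' hγ hδ
  obtain ⟨S, F, hS, hF, hR⟩ := h γ (γ' + Pi.single j 1) δ δ' (by rw [← hγ, add_assoc]) hδ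
  obtain rfl : δ' = 0 := (add_eq_zero.1 hδ).2
  refine ⟨S, F, hS, ?_, hR⟩
  convert hF using 2 with y
  rw [multiDeriv_zero, multiDeriv_zero, coordMul_apply, monomialFun_add_single, mul_assoc]

/-- Every application of a commutation relation replaces one term by two, and `SplitBound` with the
same `R` passes to both; hence the powers of 2. The factor `(2πi)⁻¹` has modulus at most 1. -/
theorem exists_norm_monomialFun_mul_multiDeriv_weylOperator_le (d : ℕ) :
    ∃ K, 0 ≤ K ∧ ∀ (α β : Fin d → ℕ) (σ : Euc d × Euc d → ℂ) (f : 𝓢(Euc d, ℂ)) (R : ℝ),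
      IsSymbol σ → SplitBound α β σ f R → ∀ x,
        ‖monomialFun α x * multiDeriv (stdBasis d) β (weylOperator σ f) x‖ ≤
          2 ^ (∑ i, α i) * 2 ^ (∑ i, β i) * (K * R) := by
  obtain ⟨K, hK, h⟩ := exists_norm_weylOperator_le d
  refine ⟨K, hK, fun α β => ?_⟩
  -- The derivatives act before the monomial, so they are moved inside first; coordinates are
  -- treated only once `β = 0`.
  induction β using multiIndex_induction with
  | zero =>
    simp only [multiDeriv_zero]
    induction α using multiIndex_induction with
    | zero =>
      intro σ f R hσ hR x
      obtain ⟨S, F, hS, hF, hSF⟩ := hR 0 0 0 0 (add_zero 0) (add_zero 0)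
      rw [append_zero_zero, multiDeriv_zero] at hS
      simp only [multiDeriv_zero, monomialFun_zero, one_mul] at hF ⊢
      simpa using (h σ f S F hσ hS hF x).trans (mul_le_mul_of_nonneg_left hSF hK)
    | step α j ih =>
      intro σ f R hσ hR x
      have h1 := ih σ (coordMul j f) R hσ hR.coordMul x
      have h2 := ih (freqDeriv j σ) f R (hσ.freqDeriv j) (hR.freqDeriv hσ) x
      have e : monomialFun (α + Pi.single j 1) x * weylOperator σ f x =
          monomialFun α x * weylOperator σ (coordMul j f) x -
          (2 * Real.pi * Complex.I)⁻¹ * (monomialFun α x * weylOperator (freqDeriv j σ) f x) := by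
        rw [monomialFun_add_single, mul_assoc, coord_mul_weylOperator hσ]
        ring
      have hc : ‖(2 * Real.pi * Complex.I : ℂ)⁻¹‖ ≤ 1 := by
        rw [norm_inv]
        refine inv_le_one_of_one_le₀ ?_
        simp [abs_of_pos Real.pi_pos]
        linarith [Real.pi_gt_three]
      have hn : ‖(2 * Real.pi * Complex.I : ℂ)⁻¹ *
          (monomialFun α x * weylOperator (freqDeriv j σ) f x)‖ ≤
          ‖monomialFun α x * weylOperator (freqDeriv j σ) f x‖ := by
        rw [norm_mul]
        exact mul_le_of_le_one_left (norm_nonneg _) hc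
      have hs : ∑ i, (α + Pi.single j 1 : Fin d → ℕ) i = ∑ i, α i + 1 := by
        simp [Finset.sum_add_distrib]
      rw [e, hs, pow_succ]
      linarith [norm_sub_le (monomialFun α x * weylOperator σ (coordMul j f) x)
        ((2 * Real.pi * Complex.I)⁻¹ * (monomialFun α x * weylOperator (freqDeriv j σ) f x))]
  | step β j ih =>
    intro σ f R hσ hR x
    have h1 := ih (posDeriv j σ) f R (hσ.posDeriv j) (hR.posDeriv hσ) x
    have h2 := ih σ (coordDeriv j f) R hσ hR.coordDeriv x
    have e : multiDeriv (stdBasis d) (β + Pi.single j 1) (weylOperator σ f) x =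
        multiDeriv (stdBasis d) β (weylOperator (posDeriv j σ) f) x +
          multiDeriv (stdBasis d) β (weylOperator σ (coordDeriv j f)) x := by
      rw [← coe_weylSchwartz hσ, multiDeriv_add_single _ β j ((weylSchwartz hσ f).smooth ⊤),
        coe_weylSchwartz hσ, dirDeriv_weylOperator hσ, ← coe_weylSchwartz (hσ.posDeriv j),
        ← coe_weylSchwartz hσ, multiDeriv_fun_add _ _ (SchwartzMap.smooth _ ⊤)
          (SchwartzMap.smooth _ ⊤)]
    have hs : ∑ i, (β + Pi.single j 1 : Fin d → ℕ) i = ∑ i, β i + 1 := by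
      simp [Finset.sum_add_distrib]
    rw [e, hs, pow_succ, mul_add]
    linarith [norm_add_le
      (monomialFun α x * multiDeriv (stdBasis d) β (weylOperator (posDeriv j σ) f) x)
      (monomialFun α x * multiDeriv (stdBasis d) β (weylOperator σ (coordDeriv j f)) x)]

/-! ### Gevrey weights under shifts and sums of multi-indices -/

/-- The weight `C^{|α|} (α!)^s`. -/
def gevreyWeight (s C : ℝ) {n : ℕ} (α : Fin n → ℕ) : ℝ :=
  C ^ (∑ i, α i) * (multiFactorial α : ℝ) ^ s

section GevreyWeight

variable {s C C' : ℝ} {n : ℕ}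

theorem gevreyWeight_nonneg (s : ℝ) (hC : 0 ≤ C) (α : Fin n → ℕ) : 0 ≤ gevreyWeight s C α := by
  unfold gevreyWeight; positivity

theorem gevreyWeight_mono (s : ℝ) (hC : 0 ≤ C) (h : C ≤ C') (α : Fin n → ℕ) :
    gevreyWeight s C α ≤ gevreyWeight s C' α := by
  unfold gevreyWeight; gcongr

theorem gevreyWeight_mul_pow (s C D : ℝ) (α : Fin n → ℕ) :
    D ^ (∑ i, α i) * gevreyWeight s C α = gevreyWeight s (D * C) α := by
  simp only [gevreyWeight, mul_pow, mul_assoc]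

theorem gevreyWeight_append (s C : ℝ) {m : ℕ} (α : Fin n → ℕ) (β : Fin m → ℕ) :
    gevreyWeight s C (Fin.append α β) = gevreyWeight s C α * gevreyWeight s C β := by
  simp only [gevreyWeight, multiFactorial, Fin.sum_univ_add, Fin.prod_univ_add, Fin.append_left,
    Fin.append_right, pow_add, Nat.cast_mul]
  rw [Real.mul_rpow (by positivity) (by positivity)]
  ring

theorem multiFactorial_add_single (α : Fin n → ℕ) (j : Fin n) :
    multiFactorial (α + Pi.single j 1) = (α j + 1) * multiFactorial α := by
  have h : ∀ i, ((α + Pi.single j 1 : Fin n → ℕ) i).factorial =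
      (if i = j then α j + 1 else 1) * (α i).factorial := by
    intro i
    rcases eq_or_ne i j with rfl | hi
    · simp [Nat.factorial_succ]
    · simp [hi]
  simp only [multiFactorial, h, Finset.prod_mul_distrib, Finset.prod_ite_eq', Finset.mem_univ,
    if_true]

/-- The extra factor `(α_j + 1)^s` is at most `2^{s|α|}`, so it is absorbed into the geometric rate.
-/
theorem gevreyWeight_add_single_le (hs : 0 ≤ s) (hC : 0 ≤ C) (α : Fin n → ℕ) (j : Fin n) :
    gevreyWeight s C (α + Pi.single j 1) ≤ C * gevreyWeight s (2 ^ s * C) α := by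
  have h1 : ((α j : ℝ) + 1) ^ s ≤ (2 ^ s) ^ (∑ i, α i) := by
    have h2 : (α j : ℝ) + 1 ≤ 2 ^ (∑ i, α i) := by
      have h3 : α j + 1 ≤ 2 ^ (∑ i, α i) := Nat.lt_two_pow_self.trans_le
        (Nat.pow_le_pow_right two_pos (Finset.single_le_sum (fun _ _ => Nat.zero_le _)
          (Finset.mem_univ j)))
      exact_mod_cast h3
    refine (Real.rpow_le_rpow (by positivity) h2 hs).trans_eq ?_
    rw [← Real.rpow_natCast, ← Real.rpow_natCast, ← Real.rpow_mul zero_le_two,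
      ← Real.rpow_mul zero_le_two, mul_comm]
  have hsum : ∑ i, (α + Pi.single j 1 : Fin n → ℕ) i = ∑ i, α i + 1 := by
    simp [Finset.sum_add_distrib]
  rw [← gevreyWeight_mul_pow, gevreyWeight, gevreyWeight, multiFactorial_add_single, hsum, pow_succ]
  push_cast
  rw [Real.mul_rpow (by positivity) (by positivity)]
  calc C ^ (∑ i, α i) * C * (((α j : ℝ) + 1) ^ s * (multiFactorial α : ℝ) ^ s)
      ≤ C ^ (∑ i, α i) * C * ((2 ^ s) ^ (∑ i, α i) * (multiFactorial α : ℝ) ^ s) := by gcongr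
    _ = _ := by ring

/-- Differentiating a monomial produces the factor `α_j ≤ 2^{|α|}`, which again costs only a larger
rate; `1 ≤ C` makes the power of `C` monotone in the exponent. -/
theorem gevreyWeight_sub_single_le (hs : 0 ≤ s) (hC : 1 ≤ C) (α : Fin n → ℕ) (j : Fin n) :
    α j * gevreyWeight s C (α - Pi.single j 1) ≤ gevreyWeight s (2 * C) α := by
  have h1 : ((α j : ℕ) : ℝ) ≤ 2 ^ (∑ i, α i) := by
    have h3 : α j ≤ 2 ^ (∑ i, α i) := (Nat.lt_two_pow_self.trans_le
        (Nat.pow_le_pow_right two_pos (Finset.single_le_sum (fun _ _ => Nat.zero_le _)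
          (Finset.mem_univ j)))).le
    exact_mod_cast h3
  rw [← gevreyWeight_mul_pow]
  refine mul_le_mul h1 ?_ (gevreyWeight_nonneg s (by linarith) _) (by positivity)
  have hle : ∀ i, (α - Pi.single j 1 : Fin n → ℕ) i ≤ α i := fun i => Nat.sub_le _ _
  have hf : multiFactorial (α - Pi.single j 1) ≤ multiFactorial α :=
    Finset.prod_le_prod' fun i _ => Nat.factorial_le (hle i)
  unfold gevreyWeight
  gcongr
  exact hle _

/-- The reason is `α! β! ≤ (α + β)!`. This recombines the bounds of the two parts of a splitting
without loss in the factorials. -/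
theorem gevreyWeight_mul_le (hs : 0 ≤ s) (hC : 0 ≤ C) {D : ℝ} (h : C ≤ D) (hC' : 0 ≤ C')
    (h' : C' ≤ D) (α β : Fin n → ℕ) :
    gevreyWeight s C α * gevreyWeight s C' β ≤ gevreyWeight s D (α + β) := by
  have hf : multiFactorial α * multiFactorial β ≤ multiFactorial (α + β) := by
    unfold multiFactorial
    rw [← Finset.prod_mul_distrib]
    exact Finset.prod_le_prod' fun i _ => Nat.le_of_dvd (Nat.factorial_pos _)
      (Nat.factorial_mul_factorial_dvd_factorial_add _ _)
  calc gevreyWeight s C α * gevreyWeight s C' β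
      ≤ gevreyWeight s D α * gevreyWeight s D β :=
        mul_le_mul (gevreyWeight_mono s hC h α) (gevreyWeight_mono s hC' h' β)
          (gevreyWeight_nonneg s hC' β) (gevreyWeight_nonneg s (hC.trans h) α)
    _ = D ^ (∑ i, (α + β) i) * ((multiFactorial α * multiFactorial β : ℕ) : ℝ) ^ s := by
        push_cast
        rw [Real.mul_rpow (by positivity) (by positivity)]
        simp only [gevreyWeight, Pi.add_apply, Finset.sum_add_distrib, pow_add]
        ring
    _ ≤ gevreyWeight s D (α + β) := by
        unfold gevreyWeight
        have : 0 ≤ D := hC.trans h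
        gcongr

theorem exists_gevreyWeight_add_le (hs : 0 ≤ s) (hC : 1 ≤ C) (n m : ℕ) :
    ∃ K C', 1 ≤ K ∧ C ≤ C' ∧ ∀ κ α : Fin n → ℕ, ∑ i, κ i ≤ m →
      gevreyWeight s C (κ + α) ≤ K * gevreyWeight s C' α := by
  have h2s : (1 : ℝ) ≤ 2 ^ s := Real.one_le_rpow one_le_two hs
  induction m with
  | zero =>
    refine ⟨1, C, le_rfl, le_rfl, fun κ α hκ => ?_⟩
    obtain rfl : κ = 0 := by
      ext i
      exact (Finset.sum_eq_zero_iff.1 (Nat.le_zero.1 hκ)) i (Finset.mem_univ i)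
    rw [zero_add, one_mul]
  | succ m ih =>
    obtain ⟨K, C', hK, hCC', h⟩ := ih
    have hC'1 := hC.trans hCC'
    have hle : C' ≤ 2 ^ s * C' := le_mul_of_one_le_left (by linarith) h2s
    refine ⟨K * C', 2 ^ s * C', one_le_mul_of_one_le_of_one_le hK hC'1, hCC'.trans hle,
      fun κ α hκ => ?_⟩
    rcases hκ.lt_or_eq with hlt | heq
    · refine (h κ α (Nat.lt_succ_iff.1 hlt)).trans ?_
      rw [mul_assoc]
      refine mul_le_mul_of_nonneg_left ?_ (by linarith)
      exact (gevreyWeight_mono s (by linarith) hle α).trans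
        (le_mul_of_one_le_left (gevreyWeight_nonneg s (by linarith) α) hC'1)
    · obtain ⟨κ₀, j, rfl, h₀⟩ := exists_add_single_of_sum_eq_succ heq
      rw [add_assoc, add_comm (Pi.single j 1), mul_assoc]
      exact (h κ₀ _ h₀.le).trans (mul_le_mul_of_nonneg_left
        (gevreyWeight_add_single_le hs (by linarith) α j) (by linarith))

end GevreyWeight

/-! ### Weighted bounds for Gelfand–Shilov functions -/

theorem gelfandShilovBound_iff {s A B M : ℝ} {f : Euc d → ℂ} :
    GelfandShilovBound s s A B M f ↔ ∀ (α β : Fin d → ℕ) (x : Euc d),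
      ‖monomialFun α x * multiDeriv (stdBasis d) β f x‖ ≤
        M * (gevreyWeight s A α * gevreyWeight s B β) := by
  have h : ∀ α β : Fin d → ℕ, M * A ^ (∑ i, α i) * B ^ (∑ i, β i) *
      (multiFactorial α : ℝ) ^ s * (multiFactorial β : ℝ) ^ s =
        M * (gevreyWeight s A α * gevreyWeight s B β) := fun α β => by
    simp only [gevreyWeight]; ring
  simp only [GelfandShilovBound, h, monomialFun]

/-- Since `|x| ≤ ∑ |x_j|`, each power of `1 + |x|` is paid for by raising the monomial by one
coordinate. -/
theorem exists_pow_mul_monomialFun_mul_le {s : ℝ} (hs : 0 ≤ s) {A : ℝ} (hA : 1 ≤ A) (d m : ℕ) :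
    ∃ K A', 1 ≤ K ∧ A ≤ A' ∧ ∀ (g : Euc d → ℂ) (M : ℝ),
      (∀ γ x, ‖monomialFun γ x * g x‖ ≤ M * gevreyWeight s A γ) →
      ∀ γ x, (1 + ‖x‖) ^ m * ‖monomialFun γ x * g x‖ ≤ K * M * gevreyWeight s A' γ := by
  have h2s : (1 : ℝ) ≤ 2 ^ s := Real.one_le_rpow one_le_two hs
  induction m with
  | zero => exact ⟨1, A, le_rfl, le_rfl, fun g M h γ x => by simpa using h γ x⟩
  | succ m ih =>
    obtain ⟨K, A', hK, hAA', h⟩ := ih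
    have hA'1 := hA.trans hAA'
    have hle : A' ≤ 2 ^ s * A' := le_mul_of_one_le_left (by linarith) h2s
    refine ⟨K * (1 + d * A'), 2 ^ s * A', ?_, hAA'.trans hle, fun g M hg γ x => ?_⟩
    · refine one_le_mul_of_one_le_of_one_le hK ?_
      have : 0 ≤ d * A' := by positivity
      linarith
    have hM : 0 ≤ M := by
      have := (norm_nonneg _).trans (hg 0 0)
      simpa [gevreyWeight, multiFactorial] using this
    have hKM : 0 ≤ K * M := by positivity
    have hj : ∀ j, (1 + ‖x‖) ^ m * (|x j| * ‖monomialFun γ x * g x‖) ≤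
        K * M * (A' * gevreyWeight s (2 ^ s * A') γ) := by
      intro j
      have h1 := h g M hg (γ + Pi.single j 1) x
      have e : ‖monomialFun (γ + Pi.single j 1) x * g x‖ = |x j| * ‖monomialFun γ x * g x‖ := by
        rw [monomialFun_add_single, mul_right_comm, norm_mul, Complex.norm_real, Real.norm_eq_abs,
          mul_comm]
      rw [e] at h1
      exact h1.trans (mul_le_mul_of_nonneg_left
        (gevreyWeight_add_single_le hs (by linarith) γ j) hKM)
    calc (1 + ‖x‖) ^ (m + 1) * ‖monomialFun γ x * g x‖
        ≤ (1 + ‖x‖) ^ m * (1 + ∑ j, |x j|) * ‖monomialFun γ x * g x‖ := by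
          rw [pow_succ]; gcongr; exact norm_le_sum_abs _
      _ = (1 + ‖x‖) ^ m * ‖monomialFun γ x * g x‖ +
          ∑ j, (1 + ‖x‖) ^ m * (|x j| * ‖monomialFun γ x * g x‖) := by
          rw [← Finset.mul_sum, ← Finset.sum_mul]; ring
      _ ≤ K * M * gevreyWeight s (2 ^ s * A') γ +
          ∑ _j : Fin d, K * M * (A' * gevreyWeight s (2 ^ s * A') γ) :=
          add_le_add ((h g M hg γ x).trans (mul_le_mul_of_nonneg_left
            (gevreyWeight_mono s (by linarith) hle γ) hKM)) (Finset.sum_le_sum fun j _ => hj j)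
      _ = K * (1 + d * A') * M * gevreyWeight s (2 ^ s * A') γ := by simp; ring

theorem dirDeriv_monomialFun_mul_multiDeriv (γ δ : Fin d → ℕ) (j : Fin d) {f : Euc d → ℂ}
    (hf : ContDiff ℝ ∞ f) :
    dirDeriv (stdBasis d j) (fun y => monomialFun γ y * multiDeriv (stdBasis d) δ f y) =
      fun y => (γ j : ℂ) * (monomialFun (γ - Pi.single j 1) y * multiDeriv (stdBasis d) δ f y) +
        monomialFun γ y * multiDeriv (stdBasis d) (δ + Pi.single j 1) f y := by
  have h : dirDeriv (stdBasis d j) (multiDeriv (stdBasis d) δ f) =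
      multiDeriv (stdBasis d) (δ + Pi.single j 1) f := by
    rw [add_comm, ← multiDeriv_multiDeriv _ _ _ hf, ← zero_add (Pi.single j 1),
      multiDeriv_add_single _ _ _ (hf.multiDeriv _ _), multiDeriv_zero]
  rw [dirDeriv_mul (contDiff_monomialFun γ) (hf.multiDeriv _ _)]
  ext y
  rw [dirDeriv_monomialFun, h, mul_assoc]

/-- By Leibniz, `∂_j (x^γ ∂^δ f)` combines two functions of the same form, with indices `(γ - e_j,
δ)` and `(γ, δ + e_j)`. The two shift estimates contribute the summands of `1 + B'`. -/
theorem exists_mul_multiDeriv_monomialFun_mul_le {s : ℝ} (hs : 0 ≤ s) {A B : ℝ} (hA : 1 ≤ A)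
    (hB : 1 ≤ B) (d m : ℕ) :
    ∃ K A' B', 1 ≤ K ∧ A ≤ A' ∧ B ≤ B' ∧ ∀ (w : Euc d → ℝ) (f : Euc d → ℂ) (M : ℝ),
      (∀ x, 0 ≤ w x) → 0 ≤ M → ContDiff ℝ ∞ f →
      (∀ γ δ x, w x * ‖monomialFun γ x * multiDeriv (stdBasis d) δ f x‖ ≤
        M * (gevreyWeight s A γ * gevreyWeight s B δ)) →
      ∀ κ, ∑ i, κ i ≤ m → ∀ γ δ x,
        w x * ‖multiDeriv (stdBasis d) κ
          (fun y => monomialFun γ y * multiDeriv (stdBasis d) δ f y) x‖ ≤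
        K * M * (gevreyWeight s A' γ * gevreyWeight s B' δ) := by
  have h2s : (1 : ℝ) ≤ 2 ^ s := Real.one_le_rpow one_le_two hs
  induction m with
  | zero =>
    refine ⟨1, A, B, le_rfl, le_rfl, le_rfl, fun w f M hw hM hf h κ hκ γ δ x => ?_⟩
    obtain rfl : κ = 0 := by
      ext i
      exact (Finset.sum_eq_zero_iff.1 (Nat.le_zero.1 hκ)) i (Finset.mem_univ i)
    rw [multiDeriv_zero, one_mul]
    exact h γ δ x
  | succ m ih =>
    obtain ⟨K, A', B', hK, hAA', hBB', h⟩ := ih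
    have hA'1 := hA.trans hAA'
    have hB'1 := hB.trans hBB'
    have hAle : A' ≤ 2 * A' := by linarith
    have hBle : B' ≤ 2 ^ s * B' := le_mul_of_one_le_left (by linarith) h2s
    refine ⟨K * (1 + B'), 2 * A', 2 ^ s * B', one_le_mul_of_one_le_of_one_le hK (by linarith),
      hAA'.trans hAle, hBB'.trans hBle, fun w f M hw hM hf hb κ hκ γ δ x => ?_⟩
    have hKM : 0 ≤ K * M := by positivity
    have hu := gevreyWeight_nonneg s (by linarith : 0 ≤ 2 * A') γ
    have hv := gevreyWeight_nonneg s (by linarith : 0 ≤ 2 ^ s * B') δ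
    have hu' := gevreyWeight_mono s (by linarith) hAle γ
    have hv' := gevreyWeight_mono s (by linarith) hBle δ
    have hv0 := gevreyWeight_nonneg s (by linarith : 0 ≤ B') δ
    have hX : 0 ≤ K * M * (gevreyWeight s (2 * A') γ * gevreyWeight s (2 ^ s * B') δ) := by
      positivity
    rcases hκ.lt_or_eq with hlt | heq
    · refine (h w f M hw hM hf hb κ (Nat.lt_succ_iff.1 hlt) γ δ x).trans ?_
      have h1 : K * M * (gevreyWeight s A' γ * gevreyWeight s B' δ) ≤
          K * M * (gevreyWeight s (2 * A') γ * gevreyWeight s (2 ^ s * B') δ) := by gcongr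
      have h2 : 0 ≤ B' * (K * M * (gevreyWeight s (2 * A') γ * gevreyWeight s (2 ^ s * B') δ)) := by
        positivity
      linarith
    · obtain ⟨κ₀, j, rfl, h₀⟩ := exists_add_single_of_sum_eq_succ heq
      have hs1 : ContDiff ℝ ∞ (fun y => monomialFun (γ - Pi.single j 1) y *
          multiDeriv (stdBasis d) δ f y) := (contDiff_monomialFun _).mul (hf.multiDeriv _ _)
      have hs2 : ContDiff ℝ ∞ (fun y => monomialFun γ y *
          multiDeriv (stdBasis d) (δ + Pi.single j 1) f y) :=
        (contDiff_monomialFun _).mul (hf.multiDeriv _ _)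
      have i1 := h w f M hw hM hf hb κ₀ h₀.le (γ - Pi.single j 1) δ x
      have i2 := h w f M hw hM hf hb κ₀ h₀.le γ (δ + Pi.single j 1) x
      rw [multiDeriv_add_single _ _ _ ((contDiff_monomialFun _).mul (hf.multiDeriv _ _)),
        dirDeriv_monomialFun_mul_multiDeriv γ δ j hf,
        multiDeriv_fun_add _ _ (contDiff_const.mul hs1) hs2, multiDeriv_const_mul _ _ _ hs1]
      have j1 := mul_le_mul_of_nonneg_left i1 (Nat.cast_nonneg (α := ℝ) (γ j))
      have k1 : (γ j : ℝ) * (K * M * (gevreyWeight s A' (γ - Pi.single j 1) *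
          gevreyWeight s B' δ)) ≤
          K * M * (gevreyWeight s (2 * A') γ * gevreyWeight s (2 ^ s * B') δ) := by
        rw [mul_left_comm, ← mul_assoc (γ j : ℝ)]
        exact mul_le_mul_of_nonneg_left (mul_le_mul (gevreyWeight_sub_single_le hs hA'1 γ j) hv'
          hv0 hu) hKM
      have k2 : K * M * (gevreyWeight s A' γ * gevreyWeight s B' (δ + Pi.single j 1)) ≤
          K * M * (gevreyWeight s (2 * A') γ * (B' * gevreyWeight s (2 ^ s * B') δ)) :=
        mul_le_mul_of_nonneg_left (mul_le_mul hu'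
          (gevreyWeight_add_single_le hs (by linarith) δ j)
          (gevreyWeight_nonneg s (by linarith) _) hu) hKM
      calc _ ≤ w x * (‖(γ j : ℂ) * multiDeriv (stdBasis d) κ₀ (fun y =>
              monomialFun (γ - Pi.single j 1) y * multiDeriv (stdBasis d) δ f y) x‖ +
            ‖multiDeriv (stdBasis d) κ₀ (fun y => monomialFun γ y *
              multiDeriv (stdBasis d) (δ + Pi.single j 1) f y) x‖) :=
            mul_le_mul_of_nonneg_left (norm_add_le _ _) (hw x)
        _ ≤ _ := by
            rw [norm_mul, Complex.norm_natCast]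
            linarith

theorem exists_weightedBound_of_gelfandShilovBound {s : ℝ} (hs : 0 ≤ s) {A B : ℝ} (hA : 0 < A)
    (hB : 0 < B) (d : ℕ) :
    ∃ K A' B', 0 ≤ K ∧ 0 < A' ∧ 0 < B' ∧ ∀ (f : Euc d → ℂ) (M : ℝ), ContDiff ℝ ∞ f →
      GelfandShilovBound s s A B M f → ∀ γ δ,
        WeightedBound (d + 1) (fun y => monomialFun γ y * multiDeriv (stdBasis d) δ f y)
          (K * M * (gevreyWeight s A' γ * gevreyWeight s B' δ)) := by
  -- The weight is gained first, for `∂^δ f` with `δ` fixed; derivatives are then taken with this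
  -- weight kept. Rates are raised to at least 1, as the shift estimates need.
  obtain ⟨K₁, A₁, hK₁, hA₁, h₁⟩ :=
    exists_pow_mul_monomialFun_mul_le hs (le_max_right A 1) d (d + 1)
  obtain ⟨K₂, A₂, B₂, hK₂, hA₂, hB₂, h₂⟩ := exists_mul_multiDeriv_monomialFun_mul_le hs
    ((le_max_right A 1).trans hA₁) (le_max_right B 1) d (d + 1)
  have hA1 := le_max_right A 1
  have hB1 := le_max_right B 1
  refine ⟨K₂ * K₁, A₂, B₂, by positivity, by linarith, by linarith,
    fun f M hf hGS γ δ κ hκ x => ?_⟩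
  have hM := hGS.const_nonneg
  have hGS' := gelfandShilovBound_iff.1 (hGS.mono hA hB (le_max_left A 1) (le_max_left B 1))
  refine (h₂ (fun x => (1 + ‖x‖) ^ (d + 1)) f (K₁ * M) (fun x => by positivity) (by positivity) hf
    (fun γ δ x => ?_) κ hκ γ δ x).trans_eq (by ring)
  refine (h₁ (multiDeriv (stdBasis d) δ f) (M * gevreyWeight s (max B 1) δ) (fun γ x => ?_)
    γ x).trans_eq (by ring)
  exact (hGS' γ δ x).trans_eq (by ring)

/-! ### Boundedness between steps, continuity and conclusion -/

theorem isSymbol_of_gevrey {σ : Euc d × Euc d → ℂ} (hσ : ContDiff ℝ ∞ σ) {s c C : ℝ}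
    (h : ∀ α z, ‖multiDeriv (stdBasisPhase d) α σ z‖ ≤ c * gevreyWeight s C α) : IsSymbol σ :=
  ⟨hσ, fun α => ⟨_, h α⟩⟩

/-- The Weyl operator maps each step of the Gelfand–Shilov space boundedly into another step. -/
theorem exists_gelfandShilovBound_weylOperator {σ : Euc d × Euc d → ℂ} (hσ : ContDiff ℝ ∞ σ)
    {s c C : ℝ} (hs : 0 ≤ s) (hc : 0 < c) (hC : 0 < C)
    (h : ∀ α z, ‖multiDeriv (stdBasisPhase d) α σ z‖ ≤ c * gevreyWeight s C α)
    {A B : ℝ} (hA : 0 < A) (hB : 0 < B) :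
    ∃ K A' B', 0 < A' ∧ 0 < B' ∧ ∀ (f : 𝓢(Euc d, ℂ)) (M : ℝ), GelfandShilovBound s s A B M f →
      GelfandShilovBound s s A' B' (K * M) (weylOperator σ f) := by
  obtain ⟨K₁, A₁, B₁, hK₁, hA₁, hB₁, h₁⟩ := exists_weightedBound_of_gelfandShilovBound hs hA hB d
  obtain ⟨K₂, C₂, hK₂, hC₂, h₂⟩ := exists_gevreyWeight_add_le hs (le_max_right C 1) (d + d) (d + 1)
  obtain ⟨K₃, hK₃, h₃⟩ := exists_norm_monomialFun_mul_multiDeriv_weylOperator_le d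
  have hsym := isSymbol_of_gevrey hσ h
  have hC₂0 : 0 < C₂ := by linarith [le_max_right C 1]
  -- A common rate for symbol and function allows their weights to be merged; the count
  -- `2^{|α|+|β|}` then doubles it.
  let D := max C₂ (max A₁ B₁)
  have hD : 0 < D := lt_max_of_lt_left hC₂0
  refine ⟨K₃ * (c * K₂ * K₁), 2 * D, 2 * D, by positivity, by positivity, fun f M hf => ?_⟩
  have hM := hf.const_nonneg
  refine gelfandShilovBound_iff.2 fun α β x => ?_
  have hsplit : SplitBound α β σ f
      (c * K₂ * (K₁ * M) * (gevreyWeight s D α * gevreyWeight s D β)) := by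
    rintro γ γ' δ δ' rfl rfl
    -- `S` bounds `∂^κ` of `∂^{(δ,γ)} σ` for `|κ| ≤ d + 1`: the shift by `κ` is absorbed in `K₂` and
    -- `C₂`.
    refine ⟨c * (K₂ * gevreyWeight s C₂ (Fin.append δ γ)), _, fun κ hκ z => ?_,
      h₁ f M (f.smooth ⊤) hf γ' δ', ?_⟩
    · rw [multiDeriv_multiDeriv _ _ _ hσ]
      refine (h _ z).trans (mul_le_mul_of_nonneg_left ?_ hc.le)
      exact (gevreyWeight_mono s hC.le (le_max_left C 1) _).trans (h₂ _ _ hκ)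
    · have e₁ := gevreyWeight_mul_le hs hC₂0.le (le_max_left C₂ (max A₁ B₁)) hA₁.le
        ((le_max_left A₁ B₁).trans (le_max_right C₂ _)) γ γ'
      have e₂ := gevreyWeight_mul_le hs hC₂0.le (le_max_left C₂ (max A₁ B₁)) hB₁.le
        ((le_max_right A₁ B₁).trans (le_max_right C₂ _)) δ δ'
      have e := mul_le_mul e₁ e₂ (mul_nonneg (gevreyWeight_nonneg s hC₂0.le _)
        (gevreyWeight_nonneg s hB₁.le _)) (gevreyWeight_nonneg s hD.le _)
      rw [gevreyWeight_append]
      refine (mul_le_mul_of_nonneg_left e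
        (by positivity : 0 ≤ c * K₂ * (K₁ * M))).trans_eq' ?_
      ring
  refine (h₃ α β σ f _ hsym hsplit x).trans_eq ?_
  rw [← gevreyWeight_mul_pow, ← gevreyWeight_mul_pow]
  ring

theorem GelfandShilov.withSeminorms (d : ℕ) (s r : ℝ) :
    WithSeminorms (fun p : ↥(GelfandShilov.stepContinuousSeminorms d s r) =>
      (p : Seminorm ℂ (GelfandShilov d s r))) := ⟨rfl⟩

/-- A linear map that sends every step of the Gelfand–Shilov space boundedly into some step is
continuous. -/
theorem GelfandShilov.continuous_of_step {s r : ℝ}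
    (T : GelfandShilov d s r →ₗ[ℂ] GelfandShilov d s r)
    (hT : ∀ A > 0, ∀ B > 0, ∃ K A' B', 0 < A' ∧ 0 < B' ∧ ∀ (f : GelfandShilov d s r) (M : ℝ),
      GelfandShilovBound s r A B M (GelfandShilov.toSchwartz f) →
        GelfandShilovBound s r A' B' (K * M) (GelfandShilov.toSchwartz (T f))) :
    Continuous T := by
  refine WithSeminorms.continuous_of_isBounded (GelfandShilov.withSeminorms d s r)
    (GelfandShilov.withSeminorms d s r) T fun p => ?_
  -- The defining family contains every seminorm bounded on all steps, so the pullback of a member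
  -- along `T` is itself a member and bounds itself with constant 1.
  have hmem : (p : Seminorm ℂ (GelfandShilov d s r)).comp T ∈
      GelfandShilov.stepContinuousSeminorms d s r := by
    intro A hA B hB
    obtain ⟨K, A', B', hA', hB', h⟩ := hT A hA B hB
    obtain ⟨K', hK'⟩ := p.2 A' hA' B' hB'
    refine ⟨K' * K, fun f M hf => ?_⟩
    rw [mul_assoc]
    exact hK' (T f) _ (h f M hf)
  refine ⟨{⟨_, hmem⟩}, 1, ?_⟩
  simp

end

theorem mainTheorem5 (d : ℕ) (s : ℝ) (hs : 1 / 2 ≤ s)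
    (σ : EuclideanSpace ℝ (Fin d) × EuclideanSpace ℝ (Fin d) → ℂ)
    (hσ : ContDiff ℝ ∞ σ)
    (hbound : ∃ c > (0 : ℝ), ∃ C > (0 : ℝ), ∀ (α : Fin (d + d) → ℕ)
      (z : EuclideanSpace ℝ (Fin d) × EuclideanSpace ℝ (Fin d)),
      ‖multiDeriv (stdBasisPhase d) α σ z‖ ≤
        c * C ^ (∑ i, α i) * (multiFactorial α : ℝ) ^ s) :
    (∀ (f : GelfandShilov d s s) (x : EuclideanSpace ℝ (Fin d)),
      (∀ ξ, Integrable (fun y => weylIntegrand σ (GelfandShilov.toSchwartz f) x ξ y)) ∧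
      Integrable (fun ξ => ∫ y, weylIntegrand σ (GelfandShilov.toSchwartz f) x ξ y)) ∧
    ∃ T : GelfandShilov d s s →L[ℂ] GelfandShilov d s s,
      ∀ (f : GelfandShilov d s s) (x : EuclideanSpace ℝ (Fin d)),
        GelfandShilov.toSchwartz (T f) x =
          weylOperator σ (GelfandShilov.toSchwartz f) x := by
  obtain ⟨c, hc, C, hC, hb⟩ := hbound
  have h : ∀ α z, ‖multiDeriv (stdBasisPhase d) α σ z‖ ≤ c * gevreyWeight s C α := fun α z =>
    (hb α z).trans_eq (mul_assoc _ _ _)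
  have hs0 : 0 ≤ s := by linarith
  have hsym := isSymbol_of_gevrey hσ h
  refine ⟨fun f x => ⟨fun ξ => integrable_weylIntegrand hsym (GelfandShilov.toSchwartz f) x ξ,
    integrable_weylInner hsym (GelfandShilov.toSchwartz f) x⟩, ?_⟩
  have hmem : ∀ f : GelfandShilov d s s,
      weylSchwartz hsym (GelfandShilov.toSchwartz f) ∈ gelfandShilovSubmodule d s s := by
    rintro ⟨f, A, hA, B, hB, M, hf⟩
    obtain ⟨K, A', B', hA', hB', hK⟩ :=
      exists_gelfandShilovBound_weylOperator hσ hs0 hc hC h hA hB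
    exact ⟨A', hA', B', hB', K * M, hK f M hf⟩
  let T : GelfandShilov d s s →ₗ[ℂ] GelfandShilov d s s :=
    { toFun := fun f => ⟨weylSchwartz hsym (GelfandShilov.toSchwartz f), hmem f⟩
      map_add' := fun f g => Subtype.ext (SchwartzMap.ext fun x => by
        exact (congrArg (fun u : 𝓢(Euc d, ℂ) => weylOperator σ u x)
          (map_add GelfandShilov.toSchwartz f g)).trans (weylOperator_add hsym _ _ x))
      map_smul' := fun a f => Subtype.ext (SchwartzMap.ext fun x => by
        exact (congrArg (fun u : 𝓢(Euc d, ℂ) => weylOperator σ u x)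
          (map_smul GelfandShilov.toSchwartz a f)).trans (weylOperator_smul σ a _ x)) }
  refine ⟨⟨T, GelfandShilov.continuous_of_step T fun A hA B hB => ?_⟩, fun f x => rfl⟩
  -- Here `K`, `A'`, `B'` are chosen from `A` and `B` before `f` and `M`, which is the uniformity
  -- that continuity needs.
  obtain ⟨K, A', B', hA', hB', hK⟩ :=
    exists_gelfandShilovBound_weylOperator hσ hs0 hc hC h hA hB
  exact ⟨K, A', B', hA', hB', fun f M hf => hK (GelfandShilov.toSchwartz f) M hf⟩
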